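/- Consider pure $\lambda$-terms up to renaming of bound variables; $(u)v$ is application, $\simeq_\beta$ is $\beta$-equivalence, "normal" means $\beta$-normal, and a term is closed if it has no free variables. A head reduction step contracts the head redex: $\lambda x_1\dots\lambda x_k\,((\lambda x\,u)v)\,v_1\dots v_m \mapsto \lambda x_1\dots\lambda x_k\,(u[v/x])\,v_1\dots v_m$. Write $u\succ v$ if $v$ is obtained from $u$ by a finite (possibly zero) number of head reduction steps. If the head reduction of $u$ terminates, $n(u)$ is its number of steps. If $u$ is normalizable, $N(u)$ is the number of steps of the left reduction (contracting the leftmost redex at each step) from $u$ to its normal form. Let $t$ be a closed normal term and $T$ a closed term. $T$ is a storage operator for $t$ if there is a term $\tau_t\simeq_\beta t$ such that for every term $\theta_t\simeq_\beta t$ there is a simultaneous substitution $\sigma$ with $(T)\theta_t f\succ (f)\sigma(\tau_t)$, where $f$ is a new variable. For a set $D$ of closed normal terms, a closed term $T$ is a storage operator for $D$ if it is a storage operator for every $t\in D$. A set of terms is recursive (recursively enumerable) if the set of its Gödel numbers is. **Theorem 4.2.** 1. Let $D$ be a set of closed normal terms and $T,T'$ closed terms. If $T$ is a storage operator for $D$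 and $T'\simeq_\beta T$, then $T'$ is a storage operator for $D$. 2. Let $D$ be a nonempty set of closed normal terms that has at least one storage operator. Then the set of all storage operators for $D$ is not recursive. For every finite set $D$ of closed normal terms, the set of all storage operators for $D$ is recursively enumerable. 3. Every finite set of closed normal terms whose elements have pairwise distinct $\beta\eta$-normal forms has a storage operator. 4. Let $t$ be a closed normal term and $T$ a storage operator for $t$. Then there are constants $A_{T,t},B_{T,t}\in\mathbb N$, depending only on $T$ and $t$, such that for every term $\theta_t\simeq_\beta t$ (with $f$ a variable not free in $\theta_t$), $\theta_t$ is normalized by left reduction, the head reduction of $(T)\theta_t f$ terminates, and $n((T)\theta_t f)\le A_{T,t}\,N(\theta_t)+B_{T,t}$. -/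

import Mathlib

/-- Pure λ-terms up to renaming of bound variables, in de Bruijn notation: `var i` under `k`
abstractions is bound if `i < k`, and otherwise denotes the free variable number `i - k`. -/
inductive LambdaTerm : Type
  | var : ℕ → LambdaTerm
  | app : LambdaTerm → LambdaTerm → LambdaTerm
  | lam : LambdaTerm → LambdaTerm

namespace LambdaTerm

/-! ### Variables and substitution -/

/-- The set of (numbers of) free variables. -/
def Fv : LambdaTerm → Set ℕ
  | var i => {i}
  | app u v => Fv u ∪ Fv v
  | lam u => {i | i + 1 ∈ Fv u}

/-- A term without free variables. -/
def Closed (t : LambdaTerm) : Prop := Fv t = ∅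

/-- Lift a map on variables under one abstraction. -/
def liftRen (ρ : ℕ → ℕ) : ℕ → ℕ
  | 0 => 0
  | i + 1 => ρ i + 1

/-- Apply a map on variables to the free variables of a term. -/
def rename : (ℕ → ℕ) → LambdaTerm → LambdaTerm
  | ρ, var i => var (ρ i)
  | ρ, app u v => app (rename ρ u) (rename ρ v)
  | ρ, lam u => lam (rename (liftRen ρ) u)

/-- Lift a substitution under one abstraction. -/
def liftSubst (σ : ℕ → LambdaTerm) : ℕ → LambdaTerm
  | 0 => var 0
  | i + 1 => rename Nat.succ (σ i)

/-- `subst σ t` is `σ(t)`: the capture-avoiding simultaneous substitution of `σ i` for each free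
variable `i` of `t`. -/
def subst : (ℕ → LambdaTerm) → LambdaTerm → LambdaTerm
  | σ, var i => σ i
  | σ, app u v => app (subst σ u) (subst σ v)
  | σ, lam u => lam (subst (liftSubst σ) u)

/-- The substitution used by `inst`: `0` becomes `v`, and the other variables go down by one. -/
def instSubst (v : LambdaTerm) : ℕ → LambdaTerm
  | 0 => v
  | i + 1 => var i

/-- The contractum `u[v/x]` of the redex `(λx u)v`. -/
def inst (u v : LambdaTerm) : LambdaTerm := subst (instSubst v) u

/-! ### Reductions -/

/-- One step of β-reduction, anywhere in the term. -/
inductive BetaStep : LambdaTerm → LambdaTerm → Prop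
  | beta (u v : LambdaTerm) : BetaStep (app (lam u) v) (inst u v)
  | appL {u u' : LambdaTerm} (v : LambdaTerm) : BetaStep u u' → BetaStep (app u v) (app u' v)
  | appR (u : LambdaTerm) {v v' : LambdaTerm} : BetaStep v v' → BetaStep (app u v) (app u v')
  | lam {u u' : LambdaTerm} : BetaStep u u' → BetaStep (lam u) (lam u')

/-- β-equivalence. -/
def BetaEq : LambdaTerm → LambdaTerm → Prop := Relation.EqvGen BetaStep

/-- Being a (β-)normal term. -/
def Normal (t : LambdaTerm) : Prop := ∀ u, ¬ BetaStep t u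

/-- One step of η-reduction, `λx (u)x → u` with `x` not free in `u`, anywhere in the term. -/
inductive EtaStep : LambdaTerm → LambdaTerm → Prop
  | eta (u : LambdaTerm) : EtaStep (lam (app (rename Nat.succ u) (var 0))) u
  | appL {u u' : LambdaTerm} (v : LambdaTerm) : EtaStep u u' → EtaStep (app u v) (app u' v)
  | appR (u : LambdaTerm) {v v' : LambdaTerm} : EtaStep v v' → EtaStep (app u v) (app u v')
  | lam {u u' : LambdaTerm} : EtaStep u u' → EtaStep (lam u) (lam u')

/-- One step of βη-reduction. -/
def BetaEtaStep (t u : LambdaTerm) : Prop := BetaStep t u ∨ EtaStep t u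

/-- `u` is a βη-normal form of `t`. -/
def IsBetaEtaNormalForm (t u : LambdaTerm) : Prop :=
  Relation.ReflTransGen BetaEtaStep t u ∧ ∀ v, ¬ BetaEtaStep u v

/-- `t` is an abstraction. -/
def IsLam (t : LambdaTerm) : Prop := ∃ u, t = lam u

/-- One step of head reduction: contraction of the head redex `(λx u)v` of
`λx₁ … λxₙ ((λx u)v) v₁ … vₘ`. -/
inductive HeadStep : LambdaTerm → LambdaTerm → Prop
  | beta (u v : LambdaTerm) : HeadStep (app (lam u) v) (inst u v)
  | appL {u u' : LambdaTerm} (v : LambdaTerm) :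
      ¬ IsLam u → HeadStep u u' → HeadStep (app u v) (app u' v)
  | lam {u u' : LambdaTerm} : HeadStep u u' → HeadStep (lam u) (lam u')

/-- `u ≻ v`: `v` is obtained from `u` by some (possibly zero) head reduction steps. -/
def HeadRed : LambdaTerm → LambdaTerm → Prop := Relation.ReflTransGen HeadStep

/-- One step of left reduction: contraction of the leftmost redex. -/
inductive LeftStep : LambdaTerm → LambdaTerm → Prop
  | beta (u v : LambdaTerm) : LeftStep (app (lam u) v) (inst u v)
  | appL {u u' : LambdaTerm} (v : LambdaTerm) :
      ¬ IsLam u → LeftStep u u' → LeftStep (app u v) (app u' v)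
  | appR {u v v' : LambdaTerm} :
      ¬ IsLam u → Normal u → LeftStep v v' → LeftStep (app u v) (app u v')
  | lam {u u' : LambdaTerm} : LeftStep u u' → LeftStep (lam u) (lam u')

/-- `Steps R k t u`: there is an `R`-reduction from `t` to `u` with exactly `k` steps. -/
def Steps (R : LambdaTerm → LambdaTerm → Prop) : ℕ → LambdaTerm → LambdaTerm → Prop
  | 0, t, u => t = u
  | k + 1, t, u => ∃ w, R t w ∧ Steps R k w u

/-- The head reduction of `t` terminates, after exactly `k` steps; that is, `n(t) = k`. -/
def HeadLength (t : LambdaTerm) (k : ℕ) : Prop :=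
  ∃ u, Steps HeadStep k t u ∧ ∀ v, ¬ HeadStep u v

/-- The left reduction of `t` reaches the normal form of `t` after exactly `k` steps; that is,
`N(t) = k`. -/
def NormLength (t : LambdaTerm) (k : ℕ) : Prop :=
  ∃ u, Steps LeftStep k t u ∧ Normal u

/-! ### Storage operators -/

/-- The closed term `T` is a storage operator for `t`: there is a term `τ ≃ t` such that for every
term `θ ≃ t` there is a substitution `σ` with `(T)θf ≻ (f)σ(τ)`, where `f` is a new variable. -/
def IsStorageOperatorFor (T t : LambdaTerm) : Prop :=
  T.Closed ∧ ∃ τ, BetaEq τ t ∧ ∀ θ, BetaEq θ t → ∀ f, f ∉ Fv θ →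
    ∃ σ : ℕ → LambdaTerm, HeadRed (app (app T θ) (var f)) (app (var f) (subst σ τ))

/-- The closed term `T` is a storage operator for every element of `D`. -/
def IsStorageOperator (D : Set LambdaTerm) (T : LambdaTerm) : Prop :=
  T.Closed ∧ ∀ t ∈ D, IsStorageOperatorFor T t

/-! ### Gödel numbering, used to speak of recursive and recursively enumerable sets of terms -/

/-- The Gödel number of a term. -/
def code : LambdaTerm → ℕ
  | var i => 3 * i
  | app u v => 3 * Nat.pair (code u) (code v) + 1
  | lam u => 3 * code u + 2

/-- Every number is the Gödel number of exactly one term. -/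
theorem code_bijective : Function.Bijective code := by
  constructor
  · intro t
    induction t with
    | var i =>
      intro u h
      cases u with
      | var j => simp only [code] at h; congr 1; omega
      | app a b => simp only [code] at h; omega
      | lam a => simp only [code] at h; omega
    | app a b iha ihb =>
      intro u h
      cases u with
      | var j => simp only [code] at h; omega
      | app c d =>
        simp only [code] at h
        have h' : Nat.pair (code a) (code b) = Nat.pair (code c) (code d) := by omega
        obtain ⟨h1, h2⟩ := Nat.pair_eq_pair.1 h'
        rw [iha h1, ihb h2]
      | lam c => simp only [code] at h; omega
    | lam a iha =>
      intro u h
      cases u with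
      | var j => simp only [code] at h; omega
      | app c d => simp only [code] at h; omega
      | lam c =>
        simp only [code] at h
        rw [iha (show code a = code c by omega)]
  · intro n
    induction n using Nat.strong_induction_on with
    | _ n ih =>
      have h3 : n % 3 = 0 ∨ n % 3 = 1 ∨ n % 3 = 2 := by omega
      rcases h3 with h | h | h
      · exact ⟨var (n / 3), by simp only [code]; omega⟩
      · have l1 := Nat.unpair_left_le (n / 3)
        have l2 := Nat.unpair_right_le (n / 3)
        obtain ⟨a, ha⟩ := ih (Nat.unpair (n / 3)).1 (by omega)
        obtain ⟨b, hb⟩ := ih (Nat.unpair (n / 3)).2 (by omega)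
        refine ⟨app a b, ?_⟩
        simp only [code, ha, hb, Nat.pair_unpair]
        omega
      · obtain ⟨a, ha⟩ := ih (n / 3) (by omega)
        exact ⟨lam a, by simp only [code, ha]; omega⟩

/-- Computability on terms is computability on their Gödel numbers. -/
noncomputable instance instPrimcodable : Primcodable LambdaTerm :=
  Primcodable.ofEquiv ℕ (Equiv.ofBijective code code_bijective)

end LambdaTerm

/-! During the head reduction of `(T)θf`, the argument `θ` is inspected only where a part of it
reaches head position. Take for `θ` the term `t` with every subterm occurrence `u` replaced by
`(x)u`, where the variable `x` serves as a mark, and head reduce: the computation blocks when a mark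
reaches the head, and resumes once that mark is erased. The pivot is `isStorageOperatorFor_iff`: `T`
is a storage operator for `t` exactly when this single symbolic computation ends in `(f)v` with `v ≃
t`.

Necessity (`IsStorageOperatorFor.symbolicRed`): put for `x` the term `(I)I…I`, which acts as the
identity, so that the marked term becomes some `θ ≃ t`. If this chain is long compared with `τ`, it
can occur in `σ(τ)` only where `τ` has a subterm headed by a free variable. So the end of the
symbolic computation differs from `τ` only at such subterms, which all disappear in the closed
normal form `t`.

Sufficiency (`SymbolicRed.realize`): by standardization, any `θ ≃ t` reaches `t` by exposing the
constructors of `t` one after the other through weak head reduction. The reduction of `(T)θf`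
therefore follows the symbolic one, and each erased mark costs at most `N(θ)` steps plus a constant.
The number of marks depends only on `T` and `t`, whence the linear bound.

The symbolic computation is defined up to β-equivalence, which gives invariance under `T' ≃ T`. It
can be run by alternating complete developments with the erasure of a head mark (`symbolicRed_iff`),
which gives recursive enumerability for finite `D`. For undecidability, a storage operator `T` is
replaced with `(F n)T`, where `F n ≃ I` if a computation halts and `F n` has an infinite weak head
reduction otherwise (`exists_undecidable_family`).

For existence, a finite form of Böhm's theorem (`exists_separator`) yields `E` with `(E)tᵢ` equal to
the `i`-th projection, and `λθλf (E)θ ((f)t₁) … ((f)tₙ)` is a storage operator. -/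

namespace LambdaTerm

/-! ### Syntax, confluence and standardization with step counts -/

open Relation

/-! ### Algebra of renamings and substitutions -/

theorem liftRen_comp (ρ' ρ : ℕ → ℕ) : liftRen ρ' ∘ liftRen ρ = liftRen (ρ' ∘ ρ) := by
  funext i; cases i <;> rfl

theorem rename_rename (t : LambdaTerm) (ρ' ρ : ℕ → ℕ) :
    rename ρ' (rename ρ t) = rename (ρ' ∘ ρ) t := by
  induction t generalizing ρ ρ' with
  | var i => rfl
  | app u v ihu ihv => simp only [rename, ihu, ihv]
  | lam u ih => simp only [rename, ih, liftRen_comp]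

theorem liftSubst_comp_liftRen (σ : ℕ → LambdaTerm) (ρ : ℕ → ℕ) :
    liftSubst σ ∘ liftRen ρ = liftSubst (σ ∘ ρ) := by
  funext i; cases i <;> rfl

theorem subst_rename (t : LambdaTerm) (σ : ℕ → LambdaTerm) (ρ : ℕ → ℕ) :
    subst σ (rename ρ t) = subst (σ ∘ ρ) t := by
  induction t generalizing ρ σ with
  | var i => rfl
  | app u v ihu ihv => simp only [rename, subst, ihu, ihv]
  | lam u ih => simp only [rename, subst, ih, liftSubst_comp_liftRen]

theorem rename_comp_liftSubst (σ : ℕ → LambdaTerm) (ρ : ℕ → ℕ) :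
    rename (liftRen ρ) ∘ liftSubst σ = liftSubst (rename ρ ∘ σ) := by
  funext i
  cases i with
  | zero => rfl
  | succ i =>
    simp only [Function.comp, liftSubst, rename_rename]
    rfl

theorem rename_subst (t : LambdaTerm) (σ : ℕ → LambdaTerm) (ρ : ℕ → ℕ) :
    rename ρ (subst σ t) = subst (rename ρ ∘ σ) t := by
  induction t generalizing ρ σ with
  | var i => rfl
  | app u v ihu ihv => simp only [rename, subst, ihu, ihv]
  | lam u ih => simp only [rename, subst, ih, rename_comp_liftSubst]

theorem subst_comp_liftSubst (σ' σ : ℕ → LambdaTerm) :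
    subst (liftSubst σ') ∘ liftSubst σ = liftSubst (subst σ' ∘ σ) := by
  funext i
  cases i with
  | zero => rfl
  | succ i =>
    simp only [Function.comp, liftSubst, subst_rename, rename_subst]
    rfl

theorem subst_subst (t : LambdaTerm) (σ' σ : ℕ → LambdaTerm) :
    subst σ' (subst σ t) = subst (subst σ' ∘ σ) t := by
  induction t generalizing σ σ' with
  | var i => rfl
  | app u v ihu ihv => simp only [subst, ihu, ihv]
  | lam u ih => simp only [subst, ih, subst_comp_liftSubst]

theorem liftSubst_var : liftSubst var = var := by
  funext i; cases i <;> rfl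

theorem subst_var (t : LambdaTerm) : subst var t = t := by
  induction t with
  | var i => rfl
  | app u v ihu ihv => simp only [subst, ihu, ihv]
  | lam u ih => simp only [subst, liftSubst_var, ih]

theorem rename_eq_subst (t : LambdaTerm) (ρ : ℕ → ℕ) : rename ρ t = subst (var ∘ ρ) t := by
  conv_lhs => rw [← subst_var (rename ρ t), subst_rename]

theorem inst_rename_succ (t v : LambdaTerm) : inst (rename Nat.succ t) v = t := by
  rw [inst, subst_rename]
  exact subst_var t

/-- The substitution `0 ↦ v`, `i + 1 ↦ σ i`. -/
def scons (v : LambdaTerm) (σ : ℕ → LambdaTerm) : ℕ → LambdaTerm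
  | 0 => v
  | i + 1 => σ i

theorem inst_subst_liftSubst (u v : LambdaTerm) (σ : ℕ → LambdaTerm) :
    inst (subst (liftSubst σ) u) v = subst (scons v σ) u := by
  rw [inst, subst_subst]
  congr 1
  funext i
  cases i with
  | zero => rfl
  | succ i => exact inst_rename_succ (σ i) v

theorem subst_inst (u v : LambdaTerm) (σ : ℕ → LambdaTerm) :
    subst σ (inst u v) = inst (subst (liftSubst σ) u) (subst σ v) := by
  rw [inst_subst_liftSubst, inst, subst_subst]
  congr 1
  funext i
  cases i <;> rfl

theorem rename_inst (u v : LambdaTerm) (ρ : ℕ → ℕ) :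
    rename ρ (inst u v) = inst (rename (liftRen ρ) u) (rename ρ v) := by
  rw [inst, inst, rename_subst, subst_rename]
  congr 1
  funext i
  cases i <;> rfl

theorem subst_congr {t : LambdaTerm} {σ σ' : ℕ → LambdaTerm} (h : ∀ i ∈ Fv t, σ i = σ' i) :
    subst σ t = subst σ' t := by
  induction t generalizing σ σ' with
  | var i => exact h i rfl
  | app u v ihu ihv =>
    simp only [subst]
    rw [ihu fun i hi => h i (Or.inl hi), ihv fun i hi => h i (Or.inr hi)]
  | lam u ih =>
    simp only [subst]
    rw [ih (σ' := liftSubst σ')]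
    intro i hi
    cases i with
    | zero => rfl
    | succ i => simp only [liftSubst, h i hi]

theorem Closed.subst_eq {t : LambdaTerm} (ht : t.Closed) (σ : ℕ → LambdaTerm) :
    subst σ t = t := by
  conv_rhs => rw [← subst_var t]
  exact subst_congr fun i hi => by rw [Closed] at ht; simp [ht] at hi

theorem Closed.rename_eq {t : LambdaTerm} (ht : t.Closed) (ρ : ℕ → ℕ) : rename ρ t = t := by
  rw [rename_eq_subst, ht.subst_eq]

/-- The free variables of the term are less than `n`. -/
def Below : ℕ → LambdaTerm → Prop
  | n, var i => i < n
  | n, app u v => Below n u ∧ Below n v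
  | n, lam u => Below (n + 1) u

theorem below_iff {n : ℕ} {t : LambdaTerm} : Below n t ↔ ∀ i ∈ Fv t, i < n := by
  induction t generalizing n with
  | var i => simp [Below, Fv]
  | app u v ihu ihv =>
    simp only [Below, Fv, ihu, ihv, Set.mem_union]
    exact ⟨fun h i hi => hi.elim (h.1 i) (h.2 i),
      fun h => ⟨fun i hi => h i (.inl hi), fun i hi => h i (.inr hi)⟩⟩
  | lam u ih =>
    simp only [Below, ih, Fv, Set.mem_ofPred_eq]
    refine ⟨fun h i hi => by have := h _ hi; omega, fun h i hi => ?_⟩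
    cases i with
    | zero => omega
    | succ i => have := h i hi; omega

theorem closed_iff_below {t : LambdaTerm} : t.Closed ↔ Below 0 t := by
  rw [below_iff, Closed, Set.eq_empty_iff_forall_notMem]
  simp

theorem Below.mono {n m : ℕ} {t : LambdaTerm} (h : Below n t) (hnm : n ≤ m) : Below m t :=
  below_iff.2 fun i hi => (below_iff.1 h i hi).trans_le hnm

theorem Closed.below {t : LambdaTerm} (h : t.Closed) (n : ℕ) : Below n t :=
  (closed_iff_below.1 h).mono (Nat.zero_le n)

theorem Below.rename {n m : ℕ} {t : LambdaTerm} (h : Below n t) {ρ : ℕ → ℕ}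
    (hρ : ∀ i < n, ρ i < m) : Below m (rename ρ t) := by
  induction t generalizing n m ρ with
  | var i => exact hρ i h
  | app u v ihu ihv => exact ⟨ihu h.1 hρ, ihv h.2 hρ⟩
  | lam u ih =>
    refine ih (n := n + 1) (m := m + 1) h fun i hi => ?_
    cases i with
    | zero => exact Nat.succ_pos _
    | succ i => exact Nat.succ_lt_succ (hρ i (Nat.lt_of_succ_lt_succ hi))

theorem Closed.app {u v : LambdaTerm} (hu : u.Closed) (hv : v.Closed) : (app u v).Closed :=
  closed_iff_below.2 ⟨closed_iff_below.1 hu, closed_iff_below.1 hv⟩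

/-! ### β-reduction and β-equivalence -/

/-- β-reduction in any number of steps. -/
def BetaRed : LambdaTerm → LambdaTerm → Prop := ReflTransGen BetaStep

theorem reflTransGen_map {R S : LambdaTerm → LambdaTerm → Prop} {F : LambdaTerm → LambdaTerm}
    (hF : ∀ a b, R a b → S (F a) (F b)) {a b : LambdaTerm} (h : ReflTransGen R a b) :
    ReflTransGen S (F a) (F b) := by
  induction h with
  | refl => exact .refl
  | tail _ h ih => exact ih.tail (hF _ _ h)

theorem BetaRed.app {u u' v v' : LambdaTerm} (hu : BetaRed u u') (hv : BetaRed v v') :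
    BetaRed (app u v) (app u' v') :=
  (reflTransGen_map (F := fun x => LambdaTerm.app x v) (fun _ _ h => .appL v h) hu).trans
    (reflTransGen_map (F := fun x => LambdaTerm.app u' x) (fun _ _ h => .appR u' h) hv)

theorem BetaRed.lam {u u' : LambdaTerm} (hu : BetaRed u u') : BetaRed (lam u) (lam u') :=
  reflTransGen_map (F := LambdaTerm.lam) (fun _ _ h => .lam h) hu

theorem BetaStep.subst {u u' : LambdaTerm} (h : BetaStep u u') (σ : ℕ → LambdaTerm) :
    BetaStep (subst σ u) (subst σ u') := by
  induction h generalizing σ with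
  | beta u v => rw [subst_inst]; exact .beta _ _
  | appL v _ ih => exact .appL _ (ih σ)
  | appR u _ ih => exact .appR _ (ih σ)
  | lam _ ih => exact .lam (ih _)

theorem BetaRed.betaEq {u v : LambdaTerm} (h : BetaRed u v) : BetaEq u v := by
  induction h with
  | refl => exact .refl _
  | tail _ h ih => exact .trans _ _ _ ih (.rel _ _ h)

@[refl] theorem BetaEq.refl (u : LambdaTerm) : BetaEq u u := EqvGen.refl u

theorem BetaEq.symm {u v : LambdaTerm} (h : BetaEq u v) : BetaEq v u := EqvGen.symm _ _ h

theorem BetaEq.trans {u v w : LambdaTerm} (h : BetaEq u v) (h' : BetaEq v w) : BetaEq u w :=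
  EqvGen.trans _ _ _ h h'

theorem BetaEq.lift {F : LambdaTerm → LambdaTerm} (hF : ∀ u v, BetaStep u v → BetaEq (F u) (F v))
    {u v : LambdaTerm} (h : BetaEq u v) : BetaEq (F u) (F v) := by
  induction h with
  | rel _ _ h => exact hF _ _ h
  | refl => exact .refl _
  | symm _ _ _ ih => exact ih.symm
  | trans _ _ _ _ _ ih ih' => exact ih.trans ih'

theorem BetaEq.app {u u' v v' : LambdaTerm} (hu : BetaEq u u') (hv : BetaEq v v') :
    BetaEq (app u v) (app u' v') :=
  (BetaEq.lift (F := fun x => LambdaTerm.app x v) (fun _ _ h => .rel _ _ (.appL v h)) hu).trans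
    (BetaEq.lift (F := fun x => LambdaTerm.app u' x) (fun _ _ h => .rel _ _ (.appR u' h)) hv)

theorem BetaEq.lam {u u' : LambdaTerm} (hu : BetaEq u u') : BetaEq (lam u) (lam u') :=
  BetaEq.lift (F := LambdaTerm.lam) (fun _ _ h => .rel _ _ (.lam h)) hu

theorem BetaEq.subst {u u' : LambdaTerm} (h : BetaEq u u') (σ : ℕ → LambdaTerm) :
    BetaEq (subst σ u) (subst σ u') :=
  BetaEq.lift (F := LambdaTerm.subst σ) (fun _ _ h => .rel _ _ (h.subst σ)) h

theorem BetaEq.rename {u u' : LambdaTerm} (h : BetaEq u u') (ρ : ℕ → ℕ) :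
    BetaEq (rename ρ u) (rename ρ u') := by
  simp only [rename_eq_subst]; exact h.subst _

theorem BetaEq.beta (u v : LambdaTerm) : BetaEq (LambdaTerm.app (.lam u) v) (inst u v) :=
  .rel _ _ (.beta u v)

/-! ### Parallel reduction and confluence -/

/-- Parallel β-reduction. -/
inductive Par : LambdaTerm → LambdaTerm → Prop
  | var (i : ℕ) : Par (var i) (var i)
  | app {u u' v v' : LambdaTerm} : Par u u' → Par v v' → Par (app u v) (app u' v')
  | lam {u u' : LambdaTerm} : Par u u' → Par (lam u) (lam u')
  | beta {u u' v v' : LambdaTerm} : Par u u' → Par v v' → Par (app (lam u) v) (inst u' v')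

theorem Par.refl (u : LambdaTerm) : Par u u := by
  induction u with
  | var i => exact .var i
  | app _ _ hu hv => exact .app hu hv
  | lam _ h => exact .lam h

theorem BetaStep.par {u v : LambdaTerm} (h : BetaStep u v) : Par u v := by
  induction h with
  | beta u v => exact .beta (.refl u) (.refl v)
  | appL v _ ih => exact .app ih (.refl v)
  | appR u _ ih => exact .app (.refl u) ih
  | lam _ ih => exact .lam ih

theorem Par.betaRed {u v : LambdaTerm} (h : Par u v) : BetaRed u v := by
  induction h with
  | var i => exact .refl
  | app _ _ hu hv => exact hu.app hv
  | lam _ ih => exact ih.lam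
  | beta _ _ hu hv => exact (hu.lam.app hv).tail (.beta _ _)

theorem Par.rename {u u' : LambdaTerm} (h : Par u u') (ρ : ℕ → ℕ) :
    Par (rename ρ u) (rename ρ u') := by
  induction h generalizing ρ with
  | var i => exact .var _
  | app _ _ hu hv => exact .app (hu ρ) (hv ρ)
  | lam _ ih => exact .lam (ih _)
  | beta _ _ hu hv => rw [rename_inst]; exact .beta (hu _) (hv _)

theorem Par.subst {u u' : LambdaTerm} (h : Par u u') {σ σ' : ℕ → LambdaTerm}
    (hσ : ∀ i, Par (σ i) (σ' i)) : Par (subst σ u) (subst σ' u') := by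
  have lift : ∀ {σ σ' : ℕ → LambdaTerm}, (∀ i, Par (σ i) (σ' i)) →
      ∀ i, Par (liftSubst σ i) (liftSubst σ' i) := fun hσ i => by
    cases i with
    | zero => exact .var 0
    | succ i => exact (hσ i).rename _
  induction h generalizing σ σ' with
  | var i => exact hσ i
  | app _ _ hu hv => exact .app (hu hσ) (hv hσ)
  | lam _ ih => exact .lam (ih (lift hσ))
  | beta _ _ hu hv => rw [subst_inst]; exact .beta (hu (lift hσ)) (hv hσ)

theorem Par.inst {u u' v v' : LambdaTerm} (hu : Par u u') (hv : Par v v') :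
    Par (inst u v) (inst u' v') :=
  hu.subst fun i => by
    cases i with
    | zero => exact hv
    | succ i => exact .var i

/-- The body of an abstraction (any other term is left unchanged). -/
def unlam : LambdaTerm → LambdaTerm
  | lam u => u
  | t => t

instance decidableIsLam : (t : LambdaTerm) → Decidable t.IsLam
  | var _ => .isFalse fun ⟨_, h⟩ => nomatch h
  | app _ _ => .isFalse fun ⟨_, h⟩ => nomatch h
  | lam u => .isTrue ⟨u, rfl⟩

/-- The complete development of a term: all its redexes are contracted. -/
def dev : LambdaTerm → LambdaTerm
  | var i => var i
  | app u v => if u.IsLam then inst (unlam (dev u)) (dev v) else app (dev u) (dev v)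
  | lam u => lam (dev u)

/-- Takahashi's triangle property: whatever set of redexes was contracted, contracting the residuals
of the others gives `dev u`. It yields both confluence and the cofinality of iterated developments.
-/
theorem Par.par_dev {u v : LambdaTerm} (h : Par u v) : Par v (dev u) := by
  induction h with
  | var i => exact .var i
  | lam _ ih => exact .lam ih
  | beta _ _ hu hv =>
    rw [dev, if_pos ⟨_, rfl⟩]
    exact hu.inst hv
  | @app u u' v v' h _ hu hv =>
    by_cases hl : u.IsLam
    · obtain ⟨u, rfl⟩ := hl
      rw [dev, if_pos ⟨_, rfl⟩]
      cases h with
      | lam h =>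
        cases hu with
        | lam hu => exact .beta hu hv
    · rw [dev, if_neg hl]
      exact .app hu hv

theorem church_rosser {u v : LambdaTerm} (h : BetaEq u v) : ∃ w, BetaRed u w ∧ BetaRed v w := by
  have key : ∀ a b c, ReflTransGen Par a b → ReflTransGen Par a c →
      Join (ReflTransGen Par) b c := fun a b c hb hc =>
    Relation.church_rosser
      (fun a b c hb hc => ⟨dev a, .single hb.par_dev, .single hc.par_dev⟩) hb hc
  have : Join (ReflTransGen Par) u v := by
    induction h with
    | rel _ _ h => exact ⟨_, .single h.par, .refl⟩
    | refl => exact ⟨_, .refl, .refl⟩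
    | symm _ _ _ ih => obtain ⟨w, h, h'⟩ := ih; exact ⟨w, h', h⟩
    | trans _ _ _ _ _ ih ih' =>
      obtain ⟨w, h1, h2⟩ := ih
      obtain ⟨w', h1', h2'⟩ := ih'
      obtain ⟨z, hz, hz'⟩ := key _ _ _ h2 h1'
      exact ⟨z, h1.trans hz, h2'.trans hz'⟩
  obtain ⟨w, hu, hv⟩ := this
  have conv : ∀ {a b}, ReflTransGen Par a b → BetaRed a b := fun h => by
    induction h with
    | refl => exact .refl
    | tail _ h ih => exact ih.trans h.betaRed
  exact ⟨w, conv hu, conv hv⟩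

theorem Normal.eq_of_betaRed {t u : LambdaTerm} (ht : t.Normal) (h : BetaRed t u) : u = t := by
  obtain rfl | ⟨v, hv, -⟩ := ReflTransGen.cases_head h
  · rfl
  · exact absurd hv (ht v)

theorem BetaEq.betaRed {u t : LambdaTerm} (h : BetaEq u t) (ht : t.Normal) : BetaRed u t := by
  obtain ⟨w, hu, hw⟩ := church_rosser h
  exact ht.eq_of_betaRed hw ▸ hu

/-- Complete developments form a cofinal strategy: each β-step is absorbed by one more development,
since `dev` is monotone for parallel reduction. This later makes the symbolic reduction computable.
-/
theorem BetaRed.iterate_dev {u v : LambdaTerm} (h : BetaRed u v) :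
    ∃ n, BetaRed v (dev^[n] u) := by
  have mono : ∀ n (a b : LambdaTerm), Par a b → Par (dev^[n] a) (dev^[n] b) := fun n => by
    induction n with
    | zero => exact fun a b h => h
    | succ n ih =>
      intro a b h
      rw [Function.iterate_succ_apply, Function.iterate_succ_apply]
      exact ih _ _ h.par_dev.par_dev
  suffices ∃ n, ReflTransGen Par v (dev^[n] u) by
    obtain ⟨n, hn⟩ := this
    refine ⟨n, ?_⟩
    generalize dev^[n] u = w at hn
    induction hn with
    | refl => exact .refl
    | tail _ h ih => exact ih.trans h.betaRed
  induction h with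
  | refl => exact ⟨0, .refl⟩
  | @tail b c _ h ih =>
    obtain ⟨n, hn⟩ := ih
    refine ⟨n + 1, ?_⟩
    rw [Function.iterate_succ_apply']
    have lift : ReflTransGen Par (dev b) (dev (dev^[n] u)) :=
      reflTransGen_map (F := dev) (fun _ _ h => h.par_dev.par_dev) hn
    exact .head h.par.par_dev lift

theorem betaEq_dev (u : LambdaTerm) : BetaEq u (dev u) := ((Par.refl u).par_dev).betaRed.betaEq

/-! ### Weak head reduction -/

/-- One step of weak head reduction. -/
inductive WhStep : LambdaTerm → LambdaTerm → Prop
  | beta (u v : LambdaTerm) : WhStep (app (lam u) v) (inst u v)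
  | appL {u u' : LambdaTerm} (v : LambdaTerm) : WhStep u u' → WhStep (app u v) (app u' v)

theorem WhStep.not_isLam {u v : LambdaTerm} (h : WhStep u v) : ¬ u.IsLam := by
  rintro ⟨w, rfl⟩; cases h

theorem WhStep.headStep {u v : LambdaTerm} (h : WhStep u v) : HeadStep u v := by
  induction h with
  | beta u v => exact .beta u v
  | appL v h ih => exact .appL v h.not_isLam ih

theorem WhStep.leftStep {u v : LambdaTerm} (h : WhStep u v) : LeftStep u v := by
  induction h with
  | beta u v => exact .beta u v
  | appL v h ih => exact .appL v h.not_isLam ih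

theorem WhStep.betaStep {u v : LambdaTerm} (h : WhStep u v) : BetaStep u v := by
  induction h with
  | beta u v => exact .beta u v
  | appL v _ ih => exact .appL v ih

theorem WhStep.subst {u v : LambdaTerm} (h : WhStep u v) (σ : ℕ → LambdaTerm) :
    WhStep (subst σ u) (subst σ v) := by
  induction h with
  | beta u v => rw [subst_inst]; exact .beta _ _
  | appL v _ ih => exact .appL _ ih

theorem WhStep.deterministic {u v w : LambdaTerm} (h : WhStep u v) (h' : WhStep u w) :
    v = w := by
  induction h generalizing w with
  | beta u v =>
    cases h' with
    | beta => rfl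
    | appL _ h => cases h
  | appL v h ih =>
    cases h' with
    | beta => cases h
    | appL _ h' => rw [ih h']

theorem HeadStep.whStep {u v : LambdaTerm} (h : HeadStep u v) (hu : ¬ u.IsLam) : WhStep u v := by
  induction h with
  | beta u v => exact .beta u v
  | appL v hl _ ih => exact .appL v (ih hl)
  | lam _ _ => exact absurd ⟨_, rfl⟩ hu

theorem HeadStep.isLam {u v : LambdaTerm} (h : HeadStep u v) (hu : u.IsLam) : v.IsLam := by
  obtain ⟨u, rfl⟩ := hu
  cases h
  exact ⟨_, rfl⟩

theorem Steps.trans {R : LambdaTerm → LambdaTerm → Prop} {j k : ℕ} {a b c : LambdaTerm}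
    (h : Steps R j a b) (h' : Steps R k b c) : Steps R (j + k) a c := by
  induction j generalizing a with
  | zero => cases h; rwa [Nat.zero_add]
  | succ j ih =>
    obtain ⟨w, hw, h⟩ := h
    rw [Nat.succ_add]
    exact ⟨w, hw, ih h⟩

theorem Steps.map {R S : LambdaTerm → LambdaTerm → Prop} {F : LambdaTerm → LambdaTerm}
    (hF : ∀ a b, R a b → S (F a) (F b)) {k : ℕ} {a b : LambdaTerm} (h : Steps R k a b) :
    Steps S k (F a) (F b) := by
  induction k generalizing a with
  | zero => cases h; rfl
  | succ k ih =>
    obtain ⟨w, hw, h⟩ := h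
    exact ⟨F w, hF _ _ hw, ih h⟩

theorem Steps.reflTransGen {R : LambdaTerm → LambdaTerm → Prop} {k : ℕ} {a b : LambdaTerm}
    (h : Steps R k a b) : ReflTransGen R a b := by
  induction k generalizing a with
  | zero => cases h; rfl
  | succ k ih =>
    obtain ⟨w, hw, h⟩ := h
    exact .head hw (ih h)

theorem exists_steps {R : LambdaTerm → LambdaTerm → Prop} {a b : LambdaTerm}
    (h : ReflTransGen R a b) : ∃ k, Steps R k a b := by
  induction h with
  | refl => exact ⟨0, rfl⟩
  | tail _ h ih =>
    obtain ⟨k, hk⟩ := ih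
    exact ⟨k + 1, hk.trans ⟨_, h, rfl⟩⟩

theorem Steps.appL {k : ℕ} {a b : LambdaTerm} (h : Steps WhStep k a b) (c : LambdaTerm) :
    Steps WhStep k (app a c) (app b c) :=
  h.map (F := fun x => LambdaTerm.app x c) fun _ _ h => .appL c h

theorem Steps.subst {k : ℕ} {a b : LambdaTerm} (h : Steps WhStep k a b) (σ : ℕ → LambdaTerm) :
    Steps WhStep k (subst σ a) (subst σ b) :=
  h.map (F := LambdaTerm.subst σ) fun _ _ h => h.subst σ

theorem Steps.betaEq {k : ℕ} {a b : LambdaTerm} (h : Steps WhStep k a b) : BetaEq a b :=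
  BetaRed.betaEq (h.map (F := id) fun _ _ h => h.betaStep).reflTransGen

/-- Weak head reduction in `j` steps is an initial part of any weak head reduction to a
weak head normal term. -/
theorem Steps.split {j k : ℕ} {a b c : LambdaTerm} (h : Steps WhStep j a b)
    (h' : Steps WhStep k a c) (hc : ∀ d, ¬ WhStep c d) : ∃ i, k = j + i ∧ Steps WhStep i b c := by
  induction j generalizing a k with
  | zero => cases h; exact ⟨k, by omega, h'⟩
  | succ j ih =>
    obtain ⟨w, hw, h⟩ := h
    cases k with
    | zero => cases h'; exact absurd hw (hc _)
    | succ k =>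
      obtain ⟨w', hw', h'⟩ := h'
      obtain rfl := hw.deterministic hw'
      obtain ⟨i, rfl, hi⟩ := ih h h'
      exact ⟨i, by omega, hi⟩

/-- An abstraction stays an abstraction under head reduction, so a head reduction ending in another
shape never works under a λ. Weak head reduction suffices from here on; it has no side condition and
commutes with substitution, step by step. -/
theorem HeadRed.steps {u v : LambdaTerm} (h : HeadRed u v) (hv : ¬ v.IsLam) :
    ∃ k, Steps WhStep k u v := by
  induction h using ReflTransGen.head_induction_on with
  | refl => exact ⟨0, rfl⟩
  | @head a b hab hbv ih =>
    obtain ⟨k, hk⟩ := ih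
    refine ⟨k + 1, b, hab.whStep fun ha => hv ?_, hk⟩
    have hb := hab.isLam ha
    clear hk hab
    induction hbv with
    | refl => exact hb
    | tail _ h ih => exact h.isLam (ih fun h' => hv (h.isLam h'))

theorem Steps.headRed {k : ℕ} {u v : LambdaTerm} (h : Steps WhStep k u v) : HeadRed u v :=
  (h.map (F := id) fun _ _ h => h.headStep).reflTransGen

/-! ### Standardization -/

/-- `Std k u v`: there is a standard reduction from `u` to `v` with exactly `k` steps. -/
inductive Std : ℕ → LambdaTerm → LambdaTerm → Prop
  | var {k : ℕ} {u : LambdaTerm} {i : ℕ} : Steps WhStep k u (var i) → Std k u (var i)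
  | app {k k₁ k₂ : ℕ} {u u₁ u₂ v₁ v₂ : LambdaTerm} : Steps WhStep k u (app u₁ u₂) →
      Std k₁ u₁ v₁ → Std k₂ u₂ v₂ → Std (k + (k₁ + k₂)) u (app v₁ v₂)
  | lam {k k₁ : ℕ} {u u₁ v₁ : LambdaTerm} : Steps WhStep k u (lam u₁) →
      Std k₁ u₁ v₁ → Std (k + k₁) u (lam v₁)

theorem Std.refl (u : LambdaTerm) : Std 0 u u := by
  induction u with
  | var i => exact .var rfl
  | app _ _ hu hv => exact .app (k := 0) rfl hu hv
  | lam _ h => exact .lam (k := 0) rfl h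

theorem Std.head {j k : ℕ} {u v w : LambdaTerm} (h : Steps WhStep j u v) (h' : Std k v w) :
    Std (j + k) u w := by
  cases h' with
  | var h' => exact .var (h.trans h')
  | app h' h₁ h₂ => rw [← Nat.add_assoc]; exact .app (h.trans h') h₁ h₂
  | lam h' h₁ => rw [← Nat.add_assoc]; exact .lam (h.trans h') h₁

theorem Std.rename {k : ℕ} {u v : LambdaTerm} (h : Std k u v) (ρ : ℕ → ℕ) :
    Std k (rename ρ u) (rename ρ v) := by
  have wh : ∀ {k a b} (ρ : ℕ → ℕ), Steps WhStep k a b →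
      Steps WhStep k (LambdaTerm.rename ρ a) (LambdaTerm.rename ρ b) := fun ρ h => by
    simp only [rename_eq_subst]; exact h.subst _
  induction h generalizing ρ with
  | var h => exact .var (wh ρ h)
  | app h _ _ h₁ h₂ => exact .app (wh ρ h) (h₁ ρ) (h₂ ρ)
  | lam h _ h₁ => exact .lam (wh ρ h) (h₁ _)

theorem Std.subst {k : ℕ} {u v : LambdaTerm} (h : Std k u v) {σ σ' : ℕ → LambdaTerm}
    (hσ : ∀ i, ∃ k, Std k (σ i) (σ' i)) : ∃ k, Std k (subst σ u) (subst σ' v) := by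
  induction h generalizing σ σ' with
  | @var _ _ i h =>
    obtain ⟨k, hk⟩ := hσ i
    exact ⟨_, hk.head (h.subst σ)⟩
  | app h _ _ h₁ h₂ =>
    obtain ⟨k₁, h₁⟩ := h₁ hσ
    obtain ⟨k₂, h₂⟩ := h₂ hσ
    exact ⟨_, .app (h.subst σ) h₁ h₂⟩
  | lam h _ h₁ =>
    obtain ⟨k₁, h₁⟩ := h₁ (σ := liftSubst σ) (σ' := liftSubst σ') fun i => by
      cases i with
      | zero => exact ⟨0, .refl _⟩
      | succ i =>
        obtain ⟨k, hk⟩ := hσ i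
        exact ⟨k, hk.rename _⟩
    exact ⟨_, .lam (h.subst σ) h₁⟩

/-- In the case of a redex, the weak head parts leading to the abstraction and then its contraction
come first, and the standard reductions of body and argument are merged by `Std.subst`. The count is
lost because substitution may duplicate the argument. -/
theorem Std.tail {k : ℕ} {u v w : LambdaTerm} (h : Std k u v) (h' : BetaStep v w) :
    ∃ k, Std k u w := by
  induction h' generalizing k u with
  | beta a b =>
    cases h with
    | app h h₁ h₂ =>
      cases h₁ with
      | lam h₁ h₁' =>
        obtain ⟨k', hk'⟩ := h₁'.subst (σ := instSubst _) (σ' := instSubst b) fun i => by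
          cases i with
          | zero => exact ⟨_, h₂⟩
          | succ i => exact ⟨0, .refl _⟩
        exact ⟨_, hk'.head (h.trans ((h₁.appL _).trans (k := 1) ⟨_, .beta _ _, rfl⟩))⟩
  | appL b _ ih =>
    cases h with
    | app h h₁ h₂ =>
      obtain ⟨k', hk'⟩ := ih h₁
      exact ⟨_, .app h hk' h₂⟩
  | appR b _ ih =>
    cases h with
    | app h h₁ h₂ =>
      obtain ⟨k', hk'⟩ := ih h₂
      exact ⟨_, .app h h₁ hk'⟩
  | lam _ ih =>
    cases h with
    | lam h h₁ =>
      obtain ⟨k', hk'⟩ := ih h₁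
      exact ⟨_, .lam h hk'⟩

theorem BetaRed.std {u v : LambdaTerm} (h : BetaRed u v) : ∃ k, Std k u v := by
  induction h with
  | refl => exact ⟨0, .refl _⟩
  | tail _ h ih =>
    obtain ⟨k, hk⟩ := ih
    exact hk.tail h

theorem BetaEq.std {u t : LambdaTerm} (h : BetaEq u t) (ht : t.Normal) : ∃ k, Std k u t :=
  (h.betaRed ht).std

theorem Normal.of_app_left {u v : LambdaTerm} (h : (app u v).Normal) : u.Normal :=
  fun _ hw => h _ (.appL v hw)

theorem Normal.of_app_right {u v : LambdaTerm} (h : (app u v).Normal) : v.Normal :=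
  fun _ hw => h _ (.appR u hw)

theorem Normal.of_lam {u : LambdaTerm} (h : (lam u).Normal) : u.Normal :=
  fun _ hw => h _ (.lam hw)

theorem Normal.not_isLam {u v : LambdaTerm} (h : (app u v).Normal) : ¬ u.IsLam := by
  rintro ⟨w, rfl⟩; exact h _ (.beta w v)

theorem LeftStep.isLam {u v : LambdaTerm} (h : LeftStep u v) (hu : u.IsLam) : v.IsLam := by
  obtain ⟨u, rfl⟩ := hu
  cases h
  exact ⟨_, rfl⟩

theorem Steps.left_isLam {k : ℕ} {u v : LambdaTerm} (h : Steps LeftStep k u v) (hu : u.IsLam) :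
    v.IsLam := by
  induction k generalizing u with
  | zero => cases h; exact hu
  | succ k ih =>
    obtain ⟨w, hw, h⟩ := h
    exact ih h (hw.isLam hu)

theorem Steps.left_appL {k : ℕ} {u v : LambdaTerm} (h : Steps LeftStep k u v) (hv : ¬ v.IsLam)
    (c : LambdaTerm) : Steps LeftStep k (app u c) (app v c) := by
  induction k generalizing u with
  | zero => cases h; rfl
  | succ k ih =>
    have hu : ¬ u.IsLam := fun hu => hv (h.left_isLam hu)
    obtain ⟨w, hw, h⟩ := h
    exact ⟨_, .appL c hu hw, ih h⟩

/-- A standard reduction to a normal form is a left reduction. -/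
theorem Std.steps_left {k : ℕ} {u v : LambdaTerm} (h : Std k u v) (hv : v.Normal) :
    Steps LeftStep k u v := by
  have wh : ∀ {k a b}, Steps WhStep k a b → Steps LeftStep k a b := fun h =>
    h.map (F := id) fun _ _ h => h.leftStep
  induction h with
  | var h => exact wh h
  | app h _ _ h₁ h₂ =>
    refine (wh h).trans (((h₁ hv.of_app_left).left_appL hv.not_isLam _).trans ?_)
    exact (h₂ hv.of_app_right).map (F := LambdaTerm.app _)
      fun _ _ h => .appR hv.not_isLam hv.of_app_left h
  | lam h _ h₁ =>
    exact (wh h).trans ((h₁ hv.of_lam).map (F := LambdaTerm.lam) fun _ _ h => .lam h)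

/-- Through this, the index of `Std` becomes the quantity `N(θ)` of the bound. -/
theorem Std.normLength {k : ℕ} {u v : LambdaTerm} (h : Std k u v) (hv : v.Normal) :
    NormLength u k :=
  ⟨v, h.steps_left hv, hv⟩

end LambdaTerm

/-! ### Characterization of storage operators by one symbolic reduction -/

namespace LambdaTerm

open Relation

/-! ### Iterated application -/

/-- `apps u [v₁, …, vₙ]` is `(u) v₁ … vₙ`. -/
def apps (u : LambdaTerm) (l : List LambdaTerm) : LambdaTerm := l.foldl app u

@[simp] theorem apps_nil (u : LambdaTerm) : apps u [] = u := rfl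

@[simp] theorem apps_cons (u v : LambdaTerm) (l : List LambdaTerm) :
    apps u (v :: l) = apps (app u v) l := rfl

theorem apps_append (u : LambdaTerm) (l l' : List LambdaTerm) :
    apps u (l ++ l') = apps (apps u l) l' := List.foldl_append

theorem apps_concat (u v : LambdaTerm) (l : List LambdaTerm) :
    apps u (l ++ [v]) = app (apps u l) v := apps_append u l [v]

theorem subst_apps (σ : ℕ → LambdaTerm) (u : LambdaTerm) (l : List LambdaTerm) :
    subst σ (apps u l) = apps (subst σ u) (l.map (subst σ)) := by
  induction l generalizing u with
  | nil => rfl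
  | cons v l ih => exact ih (app u v)

theorem rename_apps (ρ : ℕ → ℕ) (u : LambdaTerm) (l : List LambdaTerm) :
    rename ρ (apps u l) = apps (rename ρ u) (l.map (rename ρ)) := by
  induction l generalizing u with
  | nil => rfl
  | cons v l ih => exact ih (app u v)

theorem BetaEq.apps {u u' : LambdaTerm} (hu : BetaEq u u') {l l' : List LambdaTerm}
    (hl : List.Forall₂ BetaEq l l') : BetaEq (apps u l) (apps u' l') := by
  induction hl generalizing u u' with
  | nil => exact hu
  | cons h _ ih => exact ih (hu.app h)

theorem BetaEq.apps_left {u u' : LambdaTerm} (hu : BetaEq u u') (l : List LambdaTerm) :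
    BetaEq (LambdaTerm.apps u l) (LambdaTerm.apps u' l) :=
  hu.apps (List.forall₂_same.2 fun _ _ => .refl _)

theorem Steps.apps {k : ℕ} {a b : LambdaTerm} (h : Steps WhStep k a b) (l : List LambdaTerm) :
    Steps WhStep k (LambdaTerm.apps a l) (LambdaTerm.apps b l) := by
  induction l generalizing a b with
  | nil => exact h
  | cons v l ih => exact ih (h.appL v)

theorem apps_var_inj {i j : ℕ} {l l' : List LambdaTerm} (h : apps (var i) l = apps (var j) l') :
    i = j ∧ l = l' := by
  induction l using List.reverseRecOn generalizing l' with
  | nil =>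
    induction l' using List.reverseRecOn with
    | nil => simpa using h
    | append_singleton l' v _ => rw [apps_concat] at h; cases h
  | append_singleton l u ih =>
    induction l' using List.reverseRecOn with
    | nil => rw [apps_concat] at h; cases h
    | append_singleton l' v _ =>
      rw [apps_concat, apps_concat] at h
      injection h with h h'
      obtain ⟨rfl, rfl⟩ := ih h
      exact ⟨rfl, by rw [h']⟩

theorem apps_var_ne_lam (i : ℕ) (l : List LambdaTerm) : ¬ (apps (var i) l).IsLam := by
  rintro ⟨u, h⟩
  induction l using List.reverseRecOn with
  | nil => cases h
  | append_singleton l v _ => rw [apps_concat] at h; cases h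

theorem apps_var_not_whStep (i : ℕ) (l : List LambdaTerm) (u : LambdaTerm) :
    ¬ WhStep (apps (var i) l) u := by
  induction l using List.reverseRecOn generalizing u with
  | nil => intro h; cases h
  | append_singleton l v ih =>
    rw [apps_concat]
    intro h
    generalize hx : apps (var i) l = x at h ih
    cases h with
    | beta a _ => exact apps_var_ne_lam i l ⟨a, hx⟩
    | appL _ h => exact ih _ h

/-- A term has a weak head redex, or is an abstraction, or is headed by a variable. -/
theorem whStep_or_isLam_or_apps (u : LambdaTerm) :
    (∃ v, WhStep u v) ∨ u.IsLam ∨ ∃ i l, u = apps (var i) l := by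
  induction u with
  | var i => exact .inr (.inr ⟨i, [], rfl⟩)
  | lam u _ => exact .inr (.inl ⟨u, rfl⟩)
  | app u v ih _ =>
    rcases ih with ⟨w, hw⟩ | ⟨w, rfl⟩ | ⟨i, l, rfl⟩
    · exact .inl ⟨_, .appL v hw⟩
    · exact .inl ⟨_, .beta w v⟩
    · exact .inr (.inr ⟨i, l ++ [v], (apps_concat _ _ _).symm⟩)

theorem BetaStep.apps_var {i : ℕ} {l : List LambdaTerm} {u : LambdaTerm}
    (h : BetaStep (apps (var i) l) u) : ∃ l', u = apps (var i) l' ∧ List.Forall₂ BetaEq l l' := by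
  induction l using List.reverseRecOn generalizing u with
  | nil => cases h
  | append_singleton l v ih =>
    rw [apps_concat] at h
    generalize hx : LambdaTerm.apps (var i) l = x at h ih
    cases h with
    | beta a _ => exact absurd ⟨a, hx⟩ (apps_var_ne_lam i l)
    | appL _ h =>
      obtain ⟨l', rfl, hl⟩ := ih h
      exact ⟨l' ++ [v], (apps_concat _ _ _).symm, List.rel_append hl (.cons (.refl _) .nil)⟩
    | appR _ h =>
      exact ⟨l ++ [_], by rw [apps_concat, hx], List.rel_append
        (List.forall₂_same.2 fun _ _ => .refl _) (.cons (.rel _ _ h) .nil)⟩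

theorem forall₂_betaEq_trans {l l' l'' : List LambdaTerm} (h : List.Forall₂ BetaEq l l')
    (h' : List.Forall₂ BetaEq l' l'') : List.Forall₂ BetaEq l l'' := by
  induction h generalizing l'' with
  | nil => exact h'
  | cons h _ ih =>
    cases h' with
    | cons h' hl' => exact .cons (h.trans h') (ih hl')

theorem forall₂_betaEq_symm {l l' : List LambdaTerm} (h : List.Forall₂ BetaEq l l') :
    List.Forall₂ BetaEq l' l := by
  induction h with
  | nil => exact .nil
  | cons h _ ih => exact .cons h.symm ih

theorem BetaRed.apps_var {i : ℕ} {l : List LambdaTerm} {u : LambdaTerm}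
    (h : BetaRed (apps (var i) l) u) : ∃ l', u = apps (var i) l' ∧ List.Forall₂ BetaEq l l' := by
  induction h with
  | refl => exact ⟨l, rfl, List.forall₂_same.2 fun _ _ => .refl _⟩
  | tail _ h ih =>
    obtain ⟨l', rfl, hl⟩ := ih
    obtain ⟨l'', rfl, hl'⟩ := h.apps_var
    exact ⟨l'', rfl, forall₂_betaEq_trans hl hl'⟩

theorem Std.betaEq {k : ℕ} {u v : LambdaTerm} (h : Std k u v) : BetaEq u v := by
  induction h with
  | var h => exact h.betaEq
  | app h _ _ h₁ h₂ => exact h.betaEq.trans (h₁.app h₂)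
  | lam h _ h₁ => exact h.betaEq.trans h₁.lam

theorem Std.apps_var {k i : ℕ} {l : List LambdaTerm} {u : LambdaTerm}
    (h : Std k u (apps (.var i) l)) :
    ∃ j l', Steps WhStep j u (apps (.var i) l') ∧ List.Forall₂ BetaEq l' l := by
  induction l using List.reverseRecOn generalizing k u with
  | nil =>
    cases h with
    | var h => exact ⟨_, [], h, .nil⟩
  | append_singleton l v ih =>
    rw [apps_concat] at h
    cases h with
    | app h h₁ h₂ =>
      obtain ⟨j, l', hj, hl⟩ := ih h₁
      exact ⟨_, l' ++ [_], by rw [apps_concat]; exact h.trans (hj.appL _),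
        List.rel_append hl (.cons h₂.betaEq .nil)⟩

/-- A term that is β-equivalent to one headed by a variable reduces to such a term by weak head
reduction. -/
theorem BetaEq.exists_steps_apps_var {i : ℕ} {l : List LambdaTerm} {u : LambdaTerm}
    (h : BetaEq u (LambdaTerm.apps (var i) l)) :
    ∃ j l', Steps WhStep j u (LambdaTerm.apps (var i) l') ∧ List.Forall₂ BetaEq l' l := by
  obtain ⟨w, hu, hw⟩ := church_rosser h
  obtain ⟨l', rfl, hl⟩ := hw.apps_var
  obtain ⟨k, hk⟩ := hu.std
  obtain ⟨j, l'', hj, hl'⟩ := hk.apps_var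
  exact ⟨j, l'', hj, forall₂_betaEq_trans hl' (forall₂_betaEq_symm hl)⟩

theorem not_betaEq_lam_apps_var {u : LambdaTerm} {i : ℕ} {l : List LambdaTerm} :
    ¬ BetaEq (lam u) (apps (var i) l) := by
  intro h
  obtain ⟨j, l', hj, -⟩ := h.exists_steps_apps_var
  cases j with
  | zero => exact apps_var_ne_lam i l' ⟨u, hj.symm⟩
  | succ j =>
    obtain ⟨w, hw, -⟩ := hj
    cases hw

/-! ### Comparison of terms up to subterms headed by a free variable -/

/-- Under `k` abstractions, the term is headed by a free variable. -/
inductive FreeHead (k : ℕ) : LambdaTerm → Prop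
  | var {j : ℕ} : k ≤ j → FreeHead k (var j)
  | app {u v : LambdaTerm} : FreeHead k u → FreeHead k (app u v)

/-- `Covers k a b`: under `k` abstractions, `b` is obtained from `a` by replacing some subterms
headed by a free variable with arbitrary terms. -/
inductive Covers : ℕ → LambdaTerm → LambdaTerm → Prop
  | var {k j : ℕ} : j < k → Covers k (var j) (var j)
  | app {k : ℕ} {a a' b b' : LambdaTerm} : Covers k a a' → Covers k b b' →
      Covers k (app a b) (app a' b')
  | lam {k : ℕ} {a a' : LambdaTerm} : Covers (k + 1) a a' → Covers k (lam a) (lam a')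
  | freeHead {k : ℕ} {a : LambdaTerm} (b : LambdaTerm) : FreeHead k a → Covers k a b

theorem FreeHead.subst {k m : ℕ} {a : LambdaTerm} (h : FreeHead k a) {σ : ℕ → LambdaTerm}
    (hσ : ∀ j, k ≤ j → FreeHead m (σ j)) : FreeHead m (subst σ a) := by
  induction h with
  | var h => exact hσ _ h
  | app _ ih => exact .app ih

theorem FreeHead.betaStep {k : ℕ} {a b : LambdaTerm} (h : FreeHead k a) (hab : BetaStep a b) :
    FreeHead k b := by
  induction h generalizing b with
  | var h => cases hab
  | app h ih =>
    cases hab with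
    | beta => cases h
    | appL _ h' => exact .app (ih h')
    | appR _ h' => exact .app h

theorem Covers.rename {k m : ℕ} {a b : LambdaTerm} (h : Covers k a b) {ρ : ℕ → ℕ}
    (hρ : ∀ j < k, ρ j < m) (hρ' : ∀ j, k ≤ j → m ≤ ρ j) :
    Covers m (rename ρ a) (rename ρ b) := by
  induction h generalizing m ρ with
  | var h => exact .var (hρ _ h)
  | app _ _ iha ihb => exact .app (iha hρ hρ') (ihb hρ hρ')
  | lam _ ih =>
    refine .lam (ih (fun j hj => ?_) fun j hj => ?_)
    · cases j with
      | zero => exact Nat.succ_pos _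
      | succ j => exact Nat.succ_lt_succ (hρ j (Nat.lt_of_succ_lt_succ hj))
    · cases j with
      | zero => omega
      | succ j => exact Nat.succ_le_succ (hρ' j (Nat.le_of_succ_le_succ hj))
  | freeHead b h =>
    refine .freeHead _ ?_
    rw [rename_eq_subst]
    exact h.subst fun j hj => .var (hρ' j hj)

theorem Covers.subst {k m : ℕ} {a b : LambdaTerm} (h : Covers k a b) {σ σ' : ℕ → LambdaTerm}
    (hσ : ∀ j < k, Covers m (σ j) (σ' j)) (hσ' : ∀ j, k ≤ j → FreeHead m (σ j)) :
    Covers m (subst σ a) (subst σ' b) := by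
  induction h generalizing m σ σ' with
  | var h => exact hσ _ h
  | app _ _ iha ihb => exact .app (iha hσ hσ') (ihb hσ hσ')
  | lam _ ih =>
    refine .lam (ih (fun j hj => ?_) fun j hj => ?_)
    · cases j with
      | zero => exact .var (Nat.succ_pos _)
      | succ j =>
        exact (hσ j (Nat.lt_of_succ_lt_succ hj)).rename (fun i hi => Nat.succ_lt_succ hi)
          fun i hi => Nat.succ_le_succ hi
    · cases j with
      | zero => omega
      | succ j =>
        simp only [liftSubst, rename_eq_subst]
        exact (hσ' j (Nat.le_of_succ_le_succ hj)).subst fun i hi => .var (Nat.succ_le_succ hi)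
  | freeHead b h => exact .freeHead _ (h.subst hσ')

theorem Covers.inst {k : ℕ} {a a' b b' : LambdaTerm} (ha : Covers (k + 1) a a')
    (hb : Covers k b b') : Covers k (inst a b) (inst a' b') := by
  refine ha.subst (fun j hj => ?_) fun j hj => ?_
  · cases j with
    | zero => exact hb
    | succ j => exact .var (Nat.lt_of_succ_lt_succ hj)
  · cases j with
    | zero => omega
    | succ j => exact .var (Nat.le_of_succ_le_succ hj)

/-- A redex of `a` outside the replaced subterms is also a redex of `b`, because its abstraction is
not headed by a variable. A redex inside a replaced subterm leaves that subterm headed by the same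
free variable, and `b` need not move. -/
theorem Covers.betaStep {k : ℕ} {a b a' : LambdaTerm} (h : Covers k a b) (ha : BetaStep a a') :
    ∃ b', BetaRed b b' ∧ Covers k a' b' := by
  induction ha generalizing k b with
  | beta u v =>
    cases h with
    | app hu hv =>
      cases hu with
      | lam hu => exact ⟨_, .single (.beta _ _), hu.inst hv⟩
      | freeHead _ h => cases h
    | freeHead _ h => exact ⟨b, .refl, .freeHead _ (h.betaStep (.beta u v))⟩
  | appL v hu ih =>
    cases h with
    | app h h' =>
      obtain ⟨b', hb, hc⟩ := ih h
      exact ⟨_, hb.app .refl, .app hc h'⟩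
    | freeHead _ h => exact ⟨b, .refl, .freeHead _ (h.betaStep (.appL v hu))⟩
  | appR u hv ih =>
    cases h with
    | app h h' =>
      obtain ⟨b', hb, hc⟩ := ih h'
      exact ⟨_, BetaRed.app .refl hb, .app h hc⟩
    | freeHead _ h => exact ⟨b, .refl, .freeHead _ (h.betaStep (.appR u hv))⟩
  | lam hu ih =>
    cases h with
    | lam h =>
      obtain ⟨b', hb, hc⟩ := ih h
      exact ⟨_, hb.lam, .lam hc⟩
    | freeHead _ h => cases h

theorem FreeHead.not_below {k : ℕ} {a : LambdaTerm} (h : FreeHead k a) : ¬ Below k a := by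
  induction h with
  | var h => exact fun h' => absurd h' (not_lt.2 h)
  | app _ ih => exact fun h' => ih h'.1

theorem Covers.eq_of_below {k : ℕ} {a b : LambdaTerm} (h : Covers k a b) (ha : Below k a) :
    b = a := by
  induction h with
  | var => rfl
  | app _ _ iha ihb => rw [iha ha.1, ihb ha.2]
  | lam _ ih => rw [ih ha]
  | freeHead _ h => exact absurd ha h.not_below

/-- A closed term has no subterm headed by a free variable, so on reaching `t` every replaced place
has been erased. -/
theorem Covers.betaEq {a b t : LambdaTerm} (h : Covers 0 a b) (hat : BetaEq a t) (ht : t.Normal)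
    (htc : t.Closed) : BetaEq b t := by
  obtain ⟨b', hb, hc⟩ : ∃ b', BetaRed b b' ∧ Covers 0 t b' := by
    have := hat.betaRed ht
    clear hat ht htc
    induction this with
    | refl => exact ⟨b, .refl, h⟩
    | tail _ hs ih =>
      obtain ⟨b', hb, hc⟩ := ih
      obtain ⟨b'', hb', hc'⟩ := hc.betaStep hs
      exact ⟨b'', hb.trans hb', hc'⟩
  rw [hc.eq_of_below (closed_iff_below.1 htc)] at hb
  exact hb.betaEq

/-- Substituting terms headed by free variables for the free variables. -/
theorem covers_subst (a : LambdaTerm) {k : ℕ} {σ : ℕ → LambdaTerm}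
    (hσ : ∀ j < k, σ j = var j) (hσ' : ∀ j, k ≤ j → FreeHead k (σ j)) :
    Covers k (subst σ a) a := by
  induction a generalizing k σ with
  | var j =>
    by_cases hj : j < k
    · rw [subst, hσ j hj]; exact .var hj
    · exact .freeHead _ (hσ' j (not_lt.1 hj))
  | app a b iha ihb => exact .app (iha hσ hσ') (ihb hσ hσ')
  | lam a ih =>
    refine .lam (ih (fun j hj => ?_) fun j hj => ?_)
    · cases j with
      | zero => rfl
      | succ j => rw [liftSubst, hσ j (Nat.lt_of_succ_lt_succ hj)]; rfl
    · cases j with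
      | zero => omega
      | succ j =>
        simp only [liftSubst, rename_eq_subst]
        exact (hσ' j (Nat.le_of_succ_le_succ hj)).subst fun i hi => .var (Nat.succ_le_succ hi)

/-! ### Tagged terms and symbolic head reduction -/

/-- `tag W e s` is `e(s)` with every subterm occurrence `u` of `s` replaced by `(W)u`. -/
def tag : LambdaTerm → (ℕ → LambdaTerm) → LambdaTerm → LambdaTerm
  | W, e, var i => app W (e i)
  | W, e, app a b => app W (app (tag W e a) (tag W e b))
  | W, e, lam a => app W (lam (tag (rename Nat.succ W) (liftSubst e) a))

theorem subst_tag (σ : ℕ → LambdaTerm) (W : LambdaTerm) (e : ℕ → LambdaTerm) (s : LambdaTerm) :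
    subst σ (tag W e s) = tag (subst σ W) (subst σ ∘ e) s := by
  induction s generalizing σ W e with
  | var i => rfl
  | app a b iha ihb => simp only [tag, subst, iha, ihb]
  | lam a ih =>
    simp only [tag, subst, ih, subst_comp_liftSubst]
    rw [subst_rename, rename_subst]
    rfl

theorem inst_tag (W : LambdaTerm) (e : ℕ → LambdaTerm) (s c : LambdaTerm) :
    inst (tag (rename Nat.succ W) (liftSubst e) s) c = tag W (scons c e) s := by
  rw [inst, subst_tag]
  congr 1
  · exact inst_rename_succ W c
  · funext i
    cases i with
    | zero => rfl
    | succ i => exact inst_rename_succ (e i) c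

theorem tag_below {n m : ℕ} {W : LambdaTerm} {e : ℕ → LambdaTerm} {s : LambdaTerm}
    (hW : Below n W) (hs : Below m s) (he : ∀ i < m, Below n (e i)) : Below n (tag W e s) := by
  induction s generalizing n m W e with
  | var i => exact ⟨hW, he i hs⟩
  | app a b iha ihb => exact ⟨hW, iha hW hs.1 he, ihb hW hs.2 he⟩
  | lam a ih =>
    have up : ∀ {u}, Below n u → Below (n + 1) (rename Nat.succ u) := fun h =>
      h.rename fun j hj => Nat.succ_lt_succ hj
    refine ⟨hW, ih (n := n + 1) (m := m + 1) (up hW) hs fun i hi => ?_⟩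
    cases i with
    | zero => exact Nat.succ_pos _
    | succ i => exact up (he i (Nat.lt_of_succ_lt_succ hi))

theorem tag_congr {W : LambdaTerm} {e e' : ℕ → LambdaTerm} {s : LambdaTerm}
    (h : ∀ i ∈ Fv s, e i = e' i) : tag W e s = tag W e' s := by
  induction s generalizing W e e' with
  | var i => rw [tag, tag, h i rfl]
  | app a b iha ihb =>
    rw [tag, tag, iha fun i hi => h i (.inl hi), ihb fun i hi => h i (.inr hi)]
  | lam a ih =>
    rw [tag, tag, ih fun i hi => ?_]
    cases i with
    | zero => rfl
    | succ i => rw [liftSubst, liftSubst, h i hi]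

theorem betaEq_tag {W : LambdaTerm} (hW : W.Closed) (hW' : ∀ u, BetaEq (app W u) u)
    (e : ℕ → LambdaTerm) (s : LambdaTerm) : BetaEq (tag W e s) (subst e s) := by
  induction s generalizing e with
  | var i => exact hW' _
  | app a b iha ihb => exact (hW' _).trans ((iha e).app (ihb e))
  | lam a ih =>
    rw [tag, hW.rename_eq]
    exact (hW' _).trans (ih _).lam

/-- `SymbolicRed t u`: up to β-equivalence, head reduction leads from `u` to `(f)t`, where the
variable `1`, when it comes in head position, acts as the identity, and `f` is the variable `0`. -/
inductive SymbolicRed (t : LambdaTerm) : LambdaTerm → Prop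
  | done {u : LambdaTerm} : BetaEq u (app (var 0) t) → SymbolicRed t u
  | unblock {u v : LambdaTerm} {l : List LambdaTerm} : BetaEq u (apps (app (var 1) v) l) →
      SymbolicRed t (apps v l) → SymbolicRed t u

/-- Immediate because both constructors are stated up to β-equivalence; this is what makes storage
operators stable under β-equivalence. -/
theorem SymbolicRed.of_betaEq {t u v : LambdaTerm} (h : SymbolicRed t u) (huv : BetaEq v u) :
    SymbolicRed t v := by
  cases h with
  | done h => exact .done (huv.trans h)
  | unblock h h' => exact .unblock (huv.trans h) h'

theorem SymbolicRed.not_betaEq_lam {t u v : LambdaTerm} (h : SymbolicRed t u) :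
    ¬ BetaEq u (lam v) := by
  intro hu
  cases h with
  | done h => exact not_betaEq_lam_apps_var (i := 0) (l := [t]) (hu.symm.trans h)
  | @unblock _ v l h h' => exact not_betaEq_lam_apps_var (i := 1) (l := v :: l) (hu.symm.trans h)

/-- The term on which the symbolic reduction for `T` and `t` starts. -/
def symbolicStart (T t : LambdaTerm) : LambdaTerm := app (app T (tag (var 1) var t)) (var 0)

/-! ### A storage operator has a symbolic reduction -/

/-- The identity applied to `n` copies of itself. -/
def idApps : ℕ → LambdaTerm
  | 0 => lam (var 0)
  | n + 1 => app (idApps n) (lam (var 0))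

theorem idApps_closed (n : ℕ) : (idApps n).Closed := by
  rw [closed_iff_below]
  induction n with
  | zero => simp [idApps, Below]
  | succ n ih => exact ⟨ih, by simp [Below]⟩

theorem steps_idApps (n : ℕ) : Steps WhStep n (idApps n) (lam (var 0)) := by
  induction n with
  | zero => rfl
  | succ n ih => exact (ih.appL _).trans (k := 1) ⟨_, .beta _ _, rfl⟩

theorem steps_app_idApps (n : ℕ) (u : LambdaTerm) :
    Steps WhStep (n + 1) (app (idApps n) u) u :=
  ((steps_idApps n).appL u).trans (k := 1) ⟨_, .beta _ _, rfl⟩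

/-- The number of constructors of a term. -/
def size : LambdaTerm → ℕ
  | var _ => 1
  | app u v => size u + size v + 1
  | lam u => size u + 1

theorem size_pos (u : LambdaTerm) : 0 < u.size := by cases u <;> simp [size]

/-- A small term can have `idApps n` as an instance only if it is headed by a free variable. -/
theorem freeHead_of_subst_eq_idApps {a : LambdaTerm} {n k : ℕ} {σ : ℕ → LambdaTerm}
    (hσ : ∀ j < k, σ j = var j) (ha : a.size ≤ n) (h : subst σ a = idApps n) : FreeHead k a := by
  induction a generalizing n with
  | var j =>
    by_cases hj : j < k
    · rw [subst, hσ j hj] at h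
      cases n <;> cases h
    · exact .var (not_lt.1 hj)
  | lam a _ =>
    cases n with
    | zero => simp [size] at ha
    | succ n => cases h
  | app a b iha _ =>
    cases n with
    | zero => simp [size] at ha
    | succ n =>
      injection h with h _
      simp only [size] at ha
      exact .app (iha (by omega) h)

/-- The two terms have the same constructors until a variable is met on one side. A free variable of
`a` may stand for anything; where `δ` inserts `idApps n`, the corresponding subterm of `a` is too
small to have built that chain itself, so it is headed by a free variable. -/
theorem covers_of_subst_eq_subst {a b : LambdaTerm} {n k : ℕ} {σ δ : ℕ → LambdaTerm}
    (hσ : ∀ j < k, σ j = var j) (hδ : ∀ j < k, δ j = var j)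
    (hδ' : ∀ j, δ j = var j ∨ δ j = idApps n) (ha : a.size ≤ n) (h : subst σ a = subst δ b) :
    Covers k a b := by
  induction a generalizing k σ δ b with
  | var i =>
    by_cases hi : i < k
    · rw [subst, hσ i hi] at h
      cases b with
      | var j =>
        rw [subst] at h
        rcases hδ' j with hj | hj
        · rw [hj] at h
          injection h with h
          subst h
          exact .var hi
        · rw [hj] at h
          cases n <;> cases h
      | app => cases h
      | lam => cases h
    · exact .freeHead _ (.var (not_lt.1 hi))
  | app a₁ a₂ ih₁ ih₂ =>
    cases b with
    | var j =>
      refine .freeHead _ ?_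
      rcases hδ' j with hj | hj
      · rw [subst, subst, hj] at h; cases h
      · exact freeHead_of_subst_eq_idApps hσ ha (h.trans hj)
    | app b₁ b₂ =>
      simp only [size] at ha
      injection h with h₁ h₂
      exact .app (ih₁ hσ hδ hδ' (by omega) h₁) (ih₂ hσ hδ hδ' (by omega) h₂)
    | lam => cases h
  | lam a ih =>
    have lift : ∀ {σ : ℕ → LambdaTerm}, (∀ j < k, σ j = var j) →
        ∀ j < k + 1, liftSubst σ j = var j := fun hσ j hj => by
      cases j with
      | zero => rfl
      | succ j => rw [liftSubst, hσ j (Nat.lt_of_succ_lt_succ hj)]; rfl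
    cases b with
    | var j =>
      refine .freeHead _ ?_
      rcases hδ' j with hj | hj
      · rw [subst, subst, hj] at h; cases h
      · exact freeHead_of_subst_eq_idApps hσ ha (h.trans hj)
    | app => cases h
    | lam b =>
      simp only [size] at ha
      injection h with h
      refine .lam (ih (lift hσ) (lift hδ) (fun j => ?_) (by omega) h)
      cases j with
      | zero => exact .inl rfl
      | succ j =>
        rcases hδ' j with hj | hj
        · exact .inl (by rw [liftSubst, hj]; rfl)
        · exact .inr (by rw [liftSubst, hj, (idApps_closed n).rename_eq])

/-- The substitution of `idApps n` for the variable `1`. -/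
def untag (n : ℕ) : ℕ → LambdaTerm := fun i => if i = 1 then idApps n else var i

/-- The real reduction is read back symbolically: a weak head redex of `u` is contracted on both
sides, and a mark in head position becomes `idApps n`, which hands over its argument after `n + 1`
steps. Both shorten the remaining reduction. The condition on `v` is left open since it is settled
only by comparison with `τ`. -/
theorem symbolicRed_of_steps {t : LambdaTerm} (n m : ℕ) {u x : LambdaTerm}
    (h : Steps WhStep m (subst (untag n) u) (app (var 0) x)) :
    ∃ v, x = subst (untag n) v ∧ (BetaEq v t → SymbolicRed t u) := by
  have hx : ∀ w, ¬ WhStep (app (var 0) x) w := apps_var_not_whStep 0 [x]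
  induction m using Nat.strong_induction_on generalizing u with
  | _ m ih =>
  rcases whStep_or_isLam_or_apps u with ⟨u', hu⟩ | ⟨u', rfl⟩ | ⟨i, l, rfl⟩
  · obtain ⟨m', rfl, h'⟩ := Steps.split (j := 1) ⟨_, hu.subst _, rfl⟩ h hx
    obtain ⟨v, hv, hv'⟩ := ih m' (by omega) h'
    exact ⟨v, hv, fun hvt => (hv' hvt).of_betaEq (.rel _ _ hu.betaStep)⟩
  · cases m with
    | zero => cases h
    | succ m =>
      obtain ⟨w, hw, -⟩ := h
      cases hw
  · by_cases hi : i = 1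
    · subst hi
      cases l with
      | nil =>
        obtain ⟨m', -, h'⟩ := Steps.split (steps_idApps n) h hx
        cases m' with
        | zero => cases h'
        | succ m =>
          obtain ⟨w, hw, -⟩ := h'
          cases hw
      | cons v l =>
        have hs : Steps WhStep (n + 1) (subst (untag n) (apps (var 1) (v :: l)))
            (subst (untag n) (apps v l)) := by
          rw [subst_apps, subst_apps]
          exact (steps_app_idApps n _).apps _
        obtain ⟨m', rfl, h'⟩ := Steps.split hs h hx
        obtain ⟨y, hy, hy'⟩ := ih m' (by omega) h'
        exact ⟨y, hy, fun hyt => .unblock (.refl _) (hy' hyt)⟩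
    · rw [subst_apps, subst, untag, if_neg hi] at h
      cases m with
      | succ m =>
        obtain ⟨w, hw, -⟩ := h
        exact absurd hw (apps_var_not_whStep i _ w)
      | zero =>
        obtain ⟨rfl, hl⟩ := apps_var_inj (l' := [x]) h
        obtain ⟨v, rfl, hv⟩ := List.map_eq_singleton_iff.1 hl
        exact ⟨v, hv.symm, fun hvt => .done (BetaEq.app (.refl _) hvt)⟩

theorem IsStorageOperatorFor.symbolicRed {T t : LambdaTerm} (ht : t.Closed) (htn : t.Normal)
    (h : IsStorageOperatorFor T t) : SymbolicRed t (symbolicStart T t) := by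
  obtain ⟨hT, τ, hτ, h⟩ := h
  -- The chain must be at least as long as `τ`, so that `τ` cannot contain it. This is possible
  -- because `τ` is chosen before `θ`.
  let n := τ.size
  have hstart : subst (untag n) (symbolicStart T t) =
      app (app T (tag (idApps n) (untag n) t)) (var 0) := by
    simp only [symbolicStart, subst, hT.subst_eq, subst_tag]
    rfl
  have hθ : BetaEq (tag (idApps n) (untag n) t) t := by
    have := betaEq_tag (idApps_closed n) (fun u => (steps_app_idApps n u).betaEq) (untag n) t
    rwa [ht.subst_eq] at this
  have hθc : (tag (idApps n) (untag n) t).Closed :=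
    closed_iff_below.2 (tag_below ((idApps_closed n).below 0) (ht.below 0) (by simp))
  obtain ⟨σ, hσ⟩ := h _ hθ 0 (by rw [Closed] at hθc; simp [hθc])
  obtain ⟨k, hk⟩ := hσ.steps (by rintro ⟨_, h⟩; cases h)
  rw [← hstart] at hk
  obtain ⟨v, hv, hv'⟩ := symbolicRed_of_steps (t := t) n k hk
  refine hv' (Covers.betaEq (covers_of_subst_eq_subst (by simp) (by simp) (fun j => ?_) le_rfl hv)
    hτ htn ht)
  by_cases hj : j = 1
  · exact .inr (if_pos hj)
  · exact .inl (if_neg hj)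

/-! ### A symbolic reduction yields a storage operator -/

/-- Substituting terms headed by variables creates no weak head redex, so reductions of the instance
come from the term itself and can be replayed under any other substitution. -/
theorem WhStep.of_subst {ρ : ℕ → LambdaTerm} (hρ : ∀ i, ∃ j l, ρ i = apps (var j) l)
    {u v : LambdaTerm} (h : WhStep (LambdaTerm.subst ρ u) v) :
    ∃ u', WhStep u u' ∧ v = LambdaTerm.subst ρ u' := by
  induction u generalizing v with
  | var i =>
    obtain ⟨j, l, hi⟩ := hρ i
    rw [LambdaTerm.subst, hi] at h
    exact absurd h (apps_var_not_whStep _ _ _)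
  | lam u _ => cases h
  | app a b ih _ =>
    rw [LambdaTerm.subst] at h
    generalize hx : LambdaTerm.subst ρ a = x at h
    cases h with
    | beta c _ =>
      cases a with
      | var i =>
        obtain ⟨j, l, hi⟩ := hρ i
        rw [LambdaTerm.subst, hi] at hx
        exact absurd ⟨_, hx⟩ (apps_var_ne_lam j l)
      | app => cases hx
      | lam a =>
        injection hx with hx
        subst hx
        exact ⟨_, .beta _ _, (subst_inst _ _ _).symm⟩
    | appL _ h =>
      subst hx
      obtain ⟨a', ha, rfl⟩ := ih h
      exact ⟨_, .appL b ha, rfl⟩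

theorem Steps.of_subst {ρ : ℕ → LambdaTerm} (hρ : ∀ i, ∃ j l, ρ i = LambdaTerm.apps (var j) l)
    {k : ℕ} {u v : LambdaTerm} (h : Steps WhStep k (LambdaTerm.subst ρ u) v) :
    ∃ u', Steps WhStep k u u' ∧ v = LambdaTerm.subst ρ u' := by
  induction k generalizing u with
  | zero => cases h; exact ⟨u, rfl, rfl⟩
  | succ k ih =>
    obtain ⟨w, hw, h⟩ := h
    obtain ⟨w, hw', rfl⟩ := hw.of_subst hρ
    obtain ⟨u', hu, hv⟩ := ih h
    exact ⟨u', ⟨w, hw', hu⟩, hv⟩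

theorem exists_apps_var_of_subst_eq {ρ : ℕ → LambdaTerm} {u : LambdaTerm} {i : ℕ}
    {l : List LambdaTerm} (h : subst ρ u = apps (var i) l) : ∃ j l', u = apps (var j) l' := by
  induction u generalizing l with
  | var j => exact ⟨j, [], rfl⟩
  | lam u _ => exact absurd ⟨_, h.symm⟩ (apps_var_ne_lam i l)
  | app a b ih _ =>
    induction l using List.reverseRecOn with
    | nil => cases h
    | append_singleton l v _ =>
      rw [apps_concat] at h
      injection h with h _
      obtain ⟨j, l', rfl⟩ := ih h
      exact ⟨j, l' ++ [b], (apps_concat _ _ _).symm⟩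

/-- `ρ` maps `0` to itself and `i + 1` to the tagged version of the closure `(s i, e i)`. -/
def TagSubst (s : ℕ → LambdaTerm) (e : ℕ → ℕ → LambdaTerm) (ρ : ℕ → LambdaTerm) : Prop :=
  ρ 0 = var 0 ∧ ∀ i, ρ (i + 1) = tag (var 1) (subst ρ ∘ e i) (s i)

/-- `ρ` maps `0` to the variable `f` and `i + 1` to a realization of the closure `(s i, e i)`, by a
term with a standard reduction to `s i` of length at most `M`. -/
def RealSubst (s : ℕ → LambdaTerm) (e : ℕ → ℕ → LambdaTerm) (M f : ℕ) (ρ : ℕ → LambdaTerm) :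
    Prop :=
  ρ 0 = var f ∧ ∀ i, ∃ θ E, ∃ k ≤ M, Std k θ (s i) ∧ (∀ j ∈ Fv (s i), E j = subst ρ (e i j)) ∧
    ρ (i + 1) = subst E θ

/-- Insert two values after the first one. -/
def insertTwo {α : Type*} (x y : α) (ρ : ℕ → α) : ℕ → α
  | 0 => ρ 0
  | 1 => x
  | 2 => y
  | i + 3 => ρ (i + 1)

/-- Add two values in front. -/
def consTwo {α : Type*} (x y : α) (ρ : ℕ → α) : ℕ → α
  | 0 => x
  | 1 => y
  | i + 2 => ρ i

/-- The renaming that makes room for two new variables after the first one. -/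
def skipTwo : ℕ → ℕ
  | 0 => 0
  | i + 1 => i + 3

theorem insertTwo_comp_skipTwo {α : Type*} (x y : α) (ρ : ℕ → α) :
    insertTwo x y ρ ∘ skipTwo = ρ := by
  funext i; cases i <;> rfl

theorem subst_insertTwo_rename (x y u : LambdaTerm) (ρ : ℕ → LambdaTerm) :
    subst (insertTwo x y ρ) (rename skipTwo u) = subst ρ u := by
  rw [subst_rename, insertTwo_comp_skipTwo]

theorem subst_insertTwo_comp (x y : LambdaTerm) (ρ : ℕ → LambdaTerm) (e : ℕ → LambdaTerm) :
    subst (insertTwo x y ρ) ∘ (rename skipTwo ∘ e) = subst ρ ∘ e := by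
  funext i; exact subst_insertTwo_rename x y (e i) ρ

theorem map_subst_insertTwo (x y : LambdaTerm) (ρ : ℕ → LambdaTerm) (l : List LambdaTerm) :
    (l.map (rename skipTwo)).map (subst (insertTwo x y ρ)) = l.map (subst ρ) := by
  rw [List.map_map]
  exact List.map_congr_left fun u _ => subst_insertTwo_rename x y u ρ

/-- The environments obtained by adding two closures with terms in the old variables. -/
def addEnvs (c d : ℕ → LambdaTerm) (e : ℕ → ℕ → LambdaTerm) : ℕ → ℕ → LambdaTerm :=
  fun i => rename skipTwo ∘ consTwo c d e i

theorem TagSubst.addTwo {s : ℕ → LambdaTerm} {e : ℕ → ℕ → LambdaTerm} {ρ : ℕ → LambdaTerm}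
    (h : TagSubst s e ρ) (a b : LambdaTerm) (c d : ℕ → LambdaTerm) :
    TagSubst (consTwo a b s) (addEnvs c d e)
      (insertTwo (tag (var 1) (subst ρ ∘ c) a) (tag (var 1) (subst ρ ∘ d) b) ρ) := by
  refine ⟨h.1, fun i => ?_⟩
  rw [addEnvs, subst_insertTwo_comp]
  match i with
  | 0 => rfl
  | 1 => rfl
  | i + 2 => exact h.2 i

theorem RealSubst.addTwo {s : ℕ → LambdaTerm} {e : ℕ → ℕ → LambdaTerm} {M f : ℕ}
    {ρ : ℕ → LambdaTerm} (h : RealSubst s e M f ρ) {a b θ θ' : LambdaTerm} {k k' : ℕ}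
    (hk : k ≤ M) (hk' : k' ≤ M) (ha : Std k θ a) (hb : Std k' θ' b) {c d E E' : ℕ → LambdaTerm}
    (hc : ∀ j ∈ Fv a, E j = subst ρ (c j)) (hd : ∀ j ∈ Fv b, E' j = subst ρ (d j)) :
    RealSubst (consTwo a b s) (addEnvs c d e) M f (insertTwo (subst E θ) (subst E' θ') ρ) := by
  refine ⟨h.1, fun i => ?_⟩
  simp only [addEnvs, Function.comp, subst_insertTwo_rename]
  match i with
  | 0 => exact ⟨θ, E, k, hk, ha, hc, rfl⟩
  | 1 => exact ⟨θ', E', k', hk', hb, hd, rfl⟩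
  | i + 2 => exact h.2 i

theorem subst_comp_scons (ρ e : ℕ → LambdaTerm) (c : LambdaTerm) :
    subst ρ ∘ scons c e = scons (subst ρ c) (subst ρ ∘ e) := by
  funext i; cases i <;> rfl

theorem exists_tag_eq (e : ℕ → LambdaTerm) (s : LambdaTerm) :
    ∃ v, tag (var 1) e s = app (var 1) v := by
  cases s <;> exact ⟨_, rfl⟩

theorem TagSubst.exists_apps {s : ℕ → LambdaTerm} {e : ℕ → ℕ → LambdaTerm} {ρ : ℕ → LambdaTerm}
    (h : TagSubst s e ρ) (i : ℕ) : ∃ j l, ρ i = apps (var j) l := by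
  cases i with
  | zero => exact ⟨0, [], h.1⟩
  | succ i =>
    obtain ⟨v, hv⟩ := exists_tag_eq (subst ρ ∘ e i) (s i)
    exact ⟨1, [v], (h.2 i).trans hv⟩

theorem freeHead_apps_var (j : ℕ) (l : List LambdaTerm) : FreeHead 0 (apps (var j) l) := by
  induction l using List.reverseRecOn with
  | nil => exact .var (Nat.zero_le j)
  | append_singleton l v ih => rw [apps_concat]; exact .app ih

/-- Symbolic reduction determines the head reduction of every realization. -/
theorem SymbolicRed.realize {t : LambdaTerm} (ht : t.Closed) (htn : t.Normal) {u : LambdaTerm}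
    (h : SymbolicRed t u) (s : ℕ → LambdaTerm) (e : ℕ → ℕ → LambdaTerm) (ρ : ℕ → LambdaTerm)
    (u₀ : LambdaTerm) (hρ : TagSubst s e ρ) (hu : BetaEq u (subst ρ u₀)) :
    ∃ v A B, BetaEq v t ∧ ∀ M f ρ', RealSubst s e M f ρ' →
      ∃ n σ, n ≤ A * M + B ∧ Steps WhStep n (subst ρ' u₀) (app (var f) (subst σ v)) := by
  induction h generalizing s e ρ u₀ with
  | @done u h =>
    obtain ⟨k, l, hk, hl⟩ := (hu.symm.trans h).exists_steps_apps_var (i := 0) (l := [t])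
    obtain ⟨u₁, hk₁, hu₁⟩ := hk.of_subst hρ.exists_apps
    obtain ⟨j, l₁, rfl⟩ := exists_apps_var_of_subst_eq hu₁.symm
    rw [subst_apps, subst] at hu₁
    cases j with
    | succ j =>
      obtain ⟨v, hv⟩ := exists_tag_eq (subst ρ ∘ e j) (s j)
      rw [hρ.2 j, hv] at hu₁
      exact absurd (apps_var_inj (l' := v :: _) hu₁).1 (by simp)
    | zero =>
      rw [hρ.1] at hu₁
      obtain ⟨-, rfl⟩ := apps_var_inj hu₁
      cases l₁ with
      | nil => cases hl
      | cons v l₁ =>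
        cases l₁ with
        | cons => cases hl with | cons _ hl => cases hl
        | nil =>
          cases hl with
          | cons hv _ =>
            -- The term `v` is read off before `ρ'` is chosen, so the same `τ` serves all
            -- realizations; only the substitution depends on `θ`.
            refine ⟨v, 0, k, ?_, fun M f ρ' hρ' => ⟨k, ρ', by omega, ?_⟩⟩
            · refine Covers.betaEq (covers_subst v (k := 0) (by simp) fun j _ => ?_) hv htn ht
              obtain ⟨i, l, hj⟩ := hρ.exists_apps j
              rw [hj]
              exact freeHead_apps_var i l
            · have := hk₁.subst ρ'
              rwa [apps_cons, apps_nil, subst, subst, hρ'.1] at this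
  | @unblock u v l h hv ih =>
    obtain ⟨k, l', hk, hl⟩ := (hu.symm.trans h).exists_steps_apps_var (i := 1) (l := v :: l)
    obtain ⟨u₁, hk₁, hu₁⟩ := hk.of_subst hρ.exists_apps
    obtain ⟨j, l₁, rfl⟩ := exists_apps_var_of_subst_eq hu₁.symm
    rw [subst_apps, subst] at hu₁
    cases j with
    | zero =>
      rw [hρ.1] at hu₁
      exact absurd (apps_var_inj hu₁).1 (by simp)
    | succ j =>
      have hreal : ∀ M f ρ', RealSubst s e M f ρ' → ∃ θ E, ∃ k' ≤ M, Std k' θ (s j) ∧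
          (∀ i ∈ Fv (s j), E i = subst ρ' (e j i)) ∧ Steps WhStep k (subst ρ' u₀)
            -- Since `u₀` itself reduces to a term headed by the variable `j + 1`, the same `k`
            -- steps bring the realization of the closure number `j` to the head.
            (apps (subst E θ) (l₁.map (subst ρ'))) := fun M f ρ' hρ' => by
        obtain ⟨θ, E, k', hk', hθ, hE, hj⟩ := hρ'.2 j
        have := hk₁.subst ρ'
        rw [subst_apps, subst, hj] at this
        exact ⟨θ, E, k', hk', hθ, hE, this⟩
      rw [hρ.2 j] at hu₁
      cases hs : s j with
      | var y =>
        rw [hs] at hu₁ hreal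
        obtain ⟨-, rfl⟩ := apps_var_inj (l' := subst ρ (e j y) :: _) hu₁
        cases hl with
        | cons hv hl =>
          obtain ⟨x, A, B, hx, hx'⟩ := ih s e ρ (apps (e j y) l₁) hρ (by
            rw [subst_apps]; exact hv.symm.apps (forall₂_betaEq_symm hl))
          -- One more mark: `k` steps independent of `θ`, then at most `M` steps to expose the
          -- constructor of `s j`. The same accounting is used for applications, where the two
          -- subterms also have standard reductions of length at most `M`.
          refine ⟨x, A + 1, B + k, hx, fun M f ρ' hρ' => ?_⟩
          obtain ⟨θ, E, k', hk', hθ, hE, hst⟩ := hreal M f ρ' hρ'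
          obtain ⟨n, σ, hn, hn'⟩ := hx' M f ρ' hρ'
          rw [subst_apps] at hn'
          cases hθ with
          | var hθ =>
            rw [← hE y rfl] at hn'
            refine ⟨_, σ, ?_, hst.trans (((hθ.subst E).apps _).trans hn')⟩
            rw [Nat.add_mul]
            omega
      | app a b =>
        rw [hs] at hu₁ hreal
        obtain ⟨-, rfl⟩ := apps_var_inj (l' := LambdaTerm.app _ _ :: _) hu₁
        cases hl with
        | cons hv hl =>
          obtain ⟨x, A, B, hx, hx'⟩ := ih _ _ _
            (apps (LambdaTerm.app (var 1) (var 2)) (l₁.map (rename skipTwo)))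
            (hρ.addTwo a b (e j) (e j)) (by
              rw [subst_apps, map_subst_insertTwo]
              exact hv.symm.apps (forall₂_betaEq_symm hl))
          refine ⟨x, A + 1, B + k, hx, fun M f ρ' hρ' => ?_⟩
          obtain ⟨θ, E, k', hk', hθ, hE, hst⟩ := hreal M f ρ' hρ'
          cases hθ with
          | @app k₀ k₁ k₂ _ θ₁ θ₂ _ _ hθ hθ₁ hθ₂ =>
            obtain ⟨n, σ, hn, hn'⟩ := hx' M f _
              (hρ'.addTwo (by omega) (by omega) hθ₁ hθ₂ (fun i hi => hE i (.inl hi))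
                fun i hi => hE i (.inr hi))
            rw [subst_apps, map_subst_insertTwo] at hn'
            refine ⟨_, σ, ?_, hst.trans (((hθ.subst E).apps _).trans hn')⟩
            rw [Nat.add_mul]
            omega
      | lam a =>
        rw [hs] at hu₁ hreal
        obtain ⟨-, rfl⟩ := apps_var_inj (l' := LambdaTerm.lam _ :: _) hu₁
        cases hl with
        | cons hv' hl =>
          cases l₁ with
          | nil =>
            cases hl
            -- An unmarked abstraction without argument would block the symbolic reduction for good.
            exact absurd hv'.symm hv.not_betaEq_lam
          | cons c l₁ =>
            obtain ⟨x, A, B, hx, hx'⟩ := ih _ _ _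
              (apps (var 1) (l₁.map (rename skipTwo)))
              -- Only one new closure is needed; the second copy allows the construction for
              -- applications to be reused.
              (hρ.addTwo a a (scons c (e j)) (scons c (e j))) (by
                rw [subst_apps, map_subst_insertTwo]
                refine (BetaEq.apps hv'.symm (forall₂_betaEq_symm hl)).trans ?_
                refine BetaEq.apps_left ((BetaEq.beta _ _).trans ?_) _
                rw [inst_tag]
                rw [← subst_comp_scons]
                exact .refl _)
            -- The extra step contracts the redex formed by the exposed abstraction and its argument
            -- `c`.
            refine ⟨x, A + 1, B + k + 1, hx, fun M f ρ' hρ' => ?_⟩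
            obtain ⟨θ, E, k', hk', hθ, hE, hst⟩ := hreal M f ρ' hρ'
            cases hθ with
            | @lam k₀ k₁ _ θ₁ _ hθ hθ₁ =>
              have hE' : ∀ i ∈ Fv a, scons (subst ρ' c) E i = subst ρ' (scons c (e j) i) := by
                intro i hi
                cases i with
                | zero => rfl
                | succ i => exact hE i hi
              obtain ⟨n, σ, hn, hn'⟩ := hx' M f _
                (hρ'.addTwo (by omega) (by omega) hθ₁ hθ₁ hE' hE')
              rw [subst_apps, map_subst_insertTwo] at hn'
              have hb : Steps WhStep 1 (LambdaTerm.app (subst E (.lam θ₁)) (subst ρ' c))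
                  (subst (scons (subst ρ' c) E) θ₁) :=
                ⟨_, .beta _ _, inst_subst_liftSubst _ _ _⟩
              refine ⟨_, σ, ?_, hst.trans ((((hθ.subst E).appL _).apps _).trans
                ((hb.apps _).trans hn'))⟩
              rw [Nat.add_mul]
              omega

/-- The start is `((T)x₁)x₀` with every variable other than `x₀` standing for the closure of `t`. As
`t` is closed, its environment is irrelevant, and `E = var` leaves the possible free variables of
`θ` untouched. -/
theorem SymbolicRed.realize_start {T t : LambdaTerm} (h : SymbolicRed t (symbolicStart T t))
    (hT : T.Closed) (ht : t.Closed) (htn : t.Normal) :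
    ∃ v A B, BetaEq v t ∧ ∀ M θ f k, k ≤ M → Std k θ t →
      ∃ n σ, n ≤ A * M + B ∧
        Steps WhStep n (app (app T θ) (var f)) (app (var f) (subst σ v)) := by
  have hfv : ∀ i, i ∉ Fv t := fun i hi => by rw [Closed] at ht; simp [ht] at hi
  let ρ (x y : LambdaTerm) : ℕ → LambdaTerm
    | 0 => x
    | _ + 1 => y
  obtain ⟨v, A, B, hv, h⟩ := h.realize ht htn (fun _ => t) (fun _ _ => var 0)
    (ρ (var 0) (tag (var 1) var t)) (app (app T (var 1)) (var 0))
    ⟨rfl, fun i => tag_congr fun i hi => absurd hi (hfv i)⟩ (by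
      simp only [subst, hT.subst_eq]; exact .refl _)
  refine ⟨v, A, B, hv, fun M θ f k hk hθ => ?_⟩
  obtain ⟨n, σ, hn, hs⟩ := h M f (ρ (var f) θ) ⟨rfl, fun i =>
    ⟨θ, var, k, hk, hθ, fun i hi => absurd hi (hfv i), (subst_var θ).symm⟩⟩
  simp only [subst, hT.subst_eq] at hs
  exact ⟨n, σ, hn, hs⟩

theorem isStorageOperatorFor_iff {T t : LambdaTerm} (ht : t.Closed) (htn : t.Normal) :
    IsStorageOperatorFor T t ↔ T.Closed ∧ SymbolicRed t (symbolicStart T t) := by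
  refine ⟨fun h => ⟨h.1, h.symbolicRed ht htn⟩, fun ⟨hT, h⟩ => ⟨hT, ?_⟩⟩
  obtain ⟨v, A, B, hv, h⟩ := h.realize_start hT ht htn
  refine ⟨v, hv, fun θ hθ f _ => ?_⟩
  obtain ⟨k, hk⟩ := hθ.std htn
  obtain ⟨n, σ, -, hs⟩ := h k θ f k le_rfl hk
  exact ⟨σ, hs.headRed⟩

theorem IsStorageOperatorFor.of_betaEq {T T' t : LambdaTerm} (ht : t.Closed) (htn : t.Normal)
    (h : IsStorageOperatorFor T t) (hT' : T'.Closed) (hTT' : BetaEq T' T) :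
    IsStorageOperatorFor T' t := by
  rw [isStorageOperatorFor_iff ht htn] at h ⊢
  exact ⟨hT', h.2.of_betaEq ((hTT'.app (.refl _)).app (.refl _))⟩

theorem IsStorageOperator.of_betaEq {D : Set LambdaTerm} (hD : ∀ t ∈ D, t.Closed ∧ t.Normal)
    {T T' : LambdaTerm} (h : IsStorageOperator D T) (hT' : T'.Closed) (hTT' : BetaEq T' T) :
    IsStorageOperator D T' :=
  ⟨hT', fun t ht => (h.2 t ht).of_betaEq (hD t ht).1 (hD t ht).2 hT' hTT'⟩

theorem IsStorageOperatorFor.headLength_le {T t : LambdaTerm} (h : IsStorageOperatorFor T t)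
    (ht : t.Closed) (htn : t.Normal) :
    ∃ A B : ℕ, ∀ θ : LambdaTerm, BetaEq θ t → ∀ f : ℕ,
      ∃ n N : ℕ, HeadLength (app (app T θ) (var f)) n ∧ NormLength θ N ∧ n ≤ A * N + B := by
  obtain ⟨v, A, B, -, h'⟩ := (h.symbolicRed ht htn).realize_start h.1 ht htn
  refine ⟨A, B, fun θ hθ f => ?_⟩
  obtain ⟨k, hk⟩ := hθ.std htn
  obtain ⟨n, σ, hn, hs⟩ := h' k θ f k le_rfl hk
  refine ⟨n, k, ⟨_, hs.map (F := id) fun _ _ h => h.headStep, fun w hw => ?_⟩,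
    hk.normLength htn, hn⟩
  exact apps_var_not_whStep f [subst σ v] w (hw.whStep (by rintro ⟨_, h⟩; cases h))

end LambdaTerm

/-! ### The symbolic reduction as a semi-decision procedure -/

namespace LambdaTerm

open Relation

/-! ### Symbolic reduction as the iteration of a function -/

instance : Inhabited LambdaTerm := ⟨var 0⟩

noncomputable instance : DecidableEq LambdaTerm := Encodable.decidableEqOfEncodable _

/-- Remove the variable `1` when it stands in head position with at least one argument. -/
noncomputable def strip : LambdaTerm → LambdaTerm
  | var i => var i
  | app u v => if u = var 1 then v else app (strip u) v
  | lam u => lam u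

theorem strip_apps (v : LambdaTerm) (l : List LambdaTerm) :
    strip (apps (app (var 1) v) l) = apps v l := by
  induction l using List.reverseRecOn with
  | nil => exact if_pos rfl
  | append_singleton l w ih =>
    rw [apps_concat, apps_concat, strip, if_neg, ih]
    intro h
    exact absurd (apps_var_inj (l := v :: l) (l' := []) h).2 (by simp)

theorem strip_eq_or (u : LambdaTerm) : strip u = u ∨ ∃ v l, u = apps (app (var 1) v) l := by
  induction u with
  | var i => exact .inl rfl
  | lam u _ => exact .inl rfl
  | app u v ih _ =>
    by_cases hu : u = var 1
    · exact .inr ⟨v, [], by rw [hu]; rfl⟩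
    · rcases ih with h | ⟨w, l, h⟩
      · exact .inl (by rw [strip, if_neg hu, h])
      · exact .inr ⟨w, l ++ [v], by rw [h, apps_concat]⟩

theorem betaEq_apps_var {i j : ℕ} {l l' : List LambdaTerm}
    (h : BetaEq (apps (var i) l) (apps (var j) l')) : i = j ∧ List.Forall₂ BetaEq l l' := by
  obtain ⟨w, h₁, h₂⟩ := church_rosser h
  obtain ⟨l₁, rfl, hl₁⟩ := h₁.apps_var
  obtain ⟨l₂, h, hl₂⟩ := h₂.apps_var
  obtain ⟨rfl, rfl⟩ := apps_var_inj h
  exact ⟨rfl, forall₂_betaEq_trans hl₁ (forall₂_betaEq_symm hl₂)⟩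

theorem betaEq_iterate_dev (n : ℕ) (u : LambdaTerm) : BetaEq u (dev^[n] u) := by
  induction n with
  | zero => exact .refl u
  | succ n ih => rw [Function.iterate_succ_apply']; exact ih.trans (betaEq_dev _)

theorem iterate_strip_dev {n : ℕ} {u : LambdaTerm}
    (h : ∀ k, 0 < k → k ≤ n → ∀ v l, dev^[k] u ≠ apps (app (var 1) v) l) :
    (strip ∘ dev)^[n] u = dev^[n] u := by
  induction n with
  | zero => rfl
  | succ n ih =>
    rw [Function.iterate_succ_apply', ih fun k hk hkn => h k hk (by omega), Function.comp,
      Function.iterate_succ_apply']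
    refine (strip_eq_or _).resolve_right fun ⟨v, l, hvl⟩ => ?_
    exact h (n + 1) n.succ_pos le_rfl v l (by rw [Function.iterate_succ_apply', hvl])

/-- β-equivalence in `SymbolicRed` is replaced by a deterministic search: cofinality of `dev`
eventually exposes a head mark or the normal term `(f)t`, and `strip` erases the mark. -/
theorem symbolicRed_iff {t u : LambdaTerm} (ht : t.Normal) :
    SymbolicRed t u ↔ ∃ n, (strip ∘ dev)^[n] u = app (var 0) t := by
  constructor
  · suffices SymbolicRed t u → ∀ u', BetaEq u' u → ∃ n, (strip ∘ dev)^[n] u' = app (var 0) t from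
      fun h => this h u (.refl u)
    intro h
    induction h with
    | @done u h =>
      intro u' hu
      have htn : (app (var 0) t).Normal := fun w hw => by
        cases hw with
        | appL _ h => cases h
        | appR _ h => exact ht _ h
      obtain ⟨n, hn⟩ := ((hu.trans h).betaRed htn).iterate_dev
      refine ⟨n, ?_⟩
      -- `strip` never acts here: every iterate is β-equivalent to a term headed by the variable
      -- `0`, hence is not headed by a mark.
      rw [iterate_strip_dev, htn.eq_of_betaRed hn]
      intro k _ _ v l hk
      have := (hu.trans h).symm.trans (betaEq_iterate_dev k u')
      rw [hk] at this
      exact absurd (betaEq_apps_var (l := [t]) (l' := v :: l) this).1 (by simp)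
    | @unblock u v l h _ ih =>
      intro u' hu
      -- Positivity is required because `strip` is applied only after a development. Before the
      -- least such `n`, `strip ∘ dev` and `dev` have the same iterates.
      have hex : ∃ n, 0 < n ∧ ∃ w l', dev^[n] u' = apps (app (var 1) w) l' := by
        obtain ⟨w, h₁, h₂⟩ := church_rosser (hu.trans h)
        obtain ⟨l₁, rfl, hl₁⟩ := BetaRed.apps_var (l := v :: l) h₂
        obtain ⟨n, hn⟩ := h₁.iterate_dev
        have hn' : BetaRed (apps (var 1) l₁) (dev^[n + 1] u') := by
          rw [Function.iterate_succ_apply']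
          exact hn.trans (Par.refl _).par_dev.betaRed
        obtain ⟨l₂, hl, hl₂⟩ := hn'.apps_var
        cases hl₁ with
        | cons => cases hl₂ with
          | cons => exact ⟨n + 1, n.succ_pos, _, _, hl⟩
      classical
      obtain ⟨hn, w, l', hw⟩ := Nat.find_spec hex
      obtain ⟨n, hn'⟩ := Nat.exists_eq_succ_of_ne_zero hn.ne'
      rw [hn'] at hw
      have hstrip : (strip ∘ dev)^[n + 1] u' = apps w l' := by
        rw [Function.iterate_succ_apply', iterate_strip_dev, Function.comp,
          ← Function.iterate_succ_apply' dev, hw, strip_apps]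
        intro k hk hkn v l hvl
        exact Nat.find_min hex (by omega) ⟨hk, v, l, hvl⟩
      have hb : BetaEq (apps (app (var 1) w) l') (apps (app (var 1) v) l) := by
        rw [← hw]
        exact (betaEq_iterate_dev _ u').symm.trans (hu.trans h)
      obtain ⟨-, hl⟩ := betaEq_apps_var (l := w :: l') (l' := v :: l) hb
      cases hl with
      | cons hwv hl =>
        obtain ⟨m, hm⟩ := ih _ (hwv.apps hl)
        exact ⟨m + (n + 1), by rw [Function.iterate_add_apply, hstrip, hm]⟩
  · rintro ⟨n, hn⟩
    induction n generalizing u with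
    | zero =>
      rw [Function.iterate_zero, id] at hn
      exact .done (by rw [hn])
    | succ n ih =>
      rw [Function.iterate_succ_apply] at hn
      have h := ih hn
      rw [Function.comp] at h
      rcases strip_eq_or (dev u) with hs | ⟨v, l, hs⟩
      · rw [hs] at h
        exact h.of_betaEq (betaEq_dev u)
      · rw [hs, strip_apps] at h
        exact .unblock (hs ▸ betaEq_dev u) h

/-! ### Primitive recursive functions on terms -/

section Primrec

variable {α σ : Type*} [Primcodable α] [Primcodable σ]

/-- The term with a given Gödel number. -/
noncomputable def ofCode : ℕ → LambdaTerm := (Equiv.ofBijective code code_bijective).symm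

theorem ofCode_code (t : LambdaTerm) : ofCode (code t) = t :=
  (Equiv.ofBijective code code_bijective).symm_apply_apply t

theorem primrec_code : Primrec code :=
  Primrec.of_equiv (e := Equiv.ofBijective code code_bijective)

theorem primrec_ofCode : Primrec ofCode :=
  Primrec.of_equiv_symm (e := Equiv.ofBijective code code_bijective)

theorem primrec_of_code {f : α → LambdaTerm} (h : Primrec fun a => code (f a)) : Primrec f :=
  (Primrec.of_equiv_iff (Equiv.ofBijective code code_bijective)).1 h

theorem primrec_var : Primrec var :=
  primrec_of_code (Primrec.nat_mul.comp (.const 3) .id)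

theorem primrec_app : Primrec₂ app :=
  primrec_of_code (α := LambdaTerm × LambdaTerm) (Primrec.succ.comp (Primrec.nat_mul.comp (.const 3)
    (Primrec₂.natPair.comp (primrec_code.comp .fst) (primrec_code.comp .snd))))

theorem primrec_lam : Primrec lam :=
  primrec_of_code (Primrec.succ.comp (Primrec.succ.comp
    (Primrec.nat_mul.comp (.const 3) primrec_code)))

/-- The residue modulo `3` of the Gödel number tells the constructor, and the quotient gives its
arguments. -/
theorem primrec_casesOn {f : α → LambdaTerm} {V : α → ℕ → σ} {A : α → LambdaTerm × LambdaTerm → σ}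
    {L : α → LambdaTerm → σ} (hf : Primrec f) (hV : Primrec₂ V) (hA : Primrec₂ A)
    (hL : Primrec₂ L) :
    Primrec fun a => (LambdaTerm.casesOn (motive := fun _ => σ) (f a) (V a)
      (fun u v => A a (u, v)) (L a) : σ) := by
  have hc : Primrec fun a => code (f a) := primrec_code.comp hf
  have hd : Primrec fun a => code (f a) / 3 := Primrec.nat_div.comp hc (.const 3)
  have hm : Primrec fun a => code (f a) % 3 := Primrec.nat_mod.comp hc (.const 3)
  have hu : Primrec fun a => Nat.unpair (code (f a) / 3) := Primrec.unpair.comp hd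
  refine (Primrec.ite (Primrec.eq.comp hm (.const 0)) (hV.comp .id hd)
    (Primrec.ite (Primrec.eq.comp hm (.const 1))
      (hA.comp .id ((primrec_ofCode.comp (Primrec.fst.comp hu)).pair
        (primrec_ofCode.comp (Primrec.snd.comp hu))))
      (hL.comp .id (primrec_ofCode.comp hd)))).of_eq fun a => ?_
  cases f a with
  | var i =>
    have h : code (var i) % 3 = 0 := by simp only [code]; omega
    have h' : code (var i) / 3 = i := by simp only [code]; omega
    simp [h, h']
  | app u v =>
    have h : code (app u v) % 3 = 1 := by simp only [code]; omega
    have h' : code (app u v) / 3 = Nat.pair (code u) (code v) := by simp only [code]; omega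
    simp [h, h', ofCode_code]
  | lam u =>
    have h : code (lam u) % 3 = 2 := by simp only [code]; omega
    have h' : code (lam u) / 3 = code u := by simp only [code]; omega
    simp [h, h', ofCode_code]

theorem code_lt_app_left (u v : LambdaTerm) : code u < code (app u v) := by
  have := Nat.left_le_pair (code u) (code v)
  simp only [code]; omega

theorem code_lt_app_right (u v : LambdaTerm) : code v < code (app u v) := by
  have := Nat.right_le_pair (code u) (code v)
  simp only [code]; omega

theorem code_lt_lam (u : LambdaTerm) : code u < code (lam u) := by
  simp only [code]; omega

/-- Structural recursion on terms, with a parameter counting the abstractions passed. -/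
theorem primrec_rec [Inhabited σ] {f : α → ℕ × LambdaTerm → σ} {V : α → ℕ × ℕ → σ}
    {A : α → (LambdaTerm × LambdaTerm) × σ × σ → σ} {L : α → σ → σ}
    (hV : Primrec₂ V) (hA : Primrec₂ A) (hL : Primrec₂ L)
    (hvar : ∀ a k i, f a (k, var i) = V a (k, i))
    (happ : ∀ a k u v, f a (k, app u v) = A a ((u, v), f a (k, u), f a (k, v)))
    (hlam : ∀ a k u, f a (k, lam u) = L a (f a (k + 1, u))) : Primrec₂ f := by
  -- The recursion is well founded because a subterm has a smaller Gödel number, at any depth.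
  refine Primrec.nat_omega_rec f (m := fun _ b => code b.2)
    (l := fun _ b => LambdaTerm.casesOn (motive := fun _ => List (ℕ × LambdaTerm)) b.2 (fun _ => [])
      (fun u v => [(b.1, u), (b.1, v)]) (fun u => [(b.1 + 1, u)]))
    (g := fun a p => LambdaTerm.casesOn (motive := fun _ => Option σ) p.1.2
      (fun i => some (V a (p.1.1, i)))
      (fun u v => some (A a ((u, v), p.2.headI, p.2.tail.headI)))
      (fun _ => some (L a p.2.headI))) ?_ ?_ ?_ ?_ ?_
  · exact primrec_code.comp (Primrec.snd.comp .snd)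
  · refine primrec_casesOn (α := α × ℕ × LambdaTerm) (V := fun _ _ => [])
      (A := fun p q => [(p.2.1, q.1), (p.2.1, q.2)]) (L := fun p u => [(p.2.1 + 1, u)])
      (Primrec.snd.comp .snd) (.const []) ?_ ?_
    · have h : Primrec fun p : (α × ℕ × LambdaTerm) × LambdaTerm × LambdaTerm => p.1.2.1 :=
        Primrec.fst.comp (Primrec.snd.comp .fst)
      exact Primrec.list_cons.comp (h.pair (Primrec.fst.comp .snd))
        (Primrec.list_cons.comp (h.pair (Primrec.snd.comp .snd)) (.const []))
    · have h : Primrec fun p : (α × ℕ × LambdaTerm) × LambdaTerm => p.1.2.1 :=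
        Primrec.fst.comp (Primrec.snd.comp .fst)
      exact Primrec.list_cons.comp ((Primrec.succ.comp h).pair .snd) (.const [])
  · refine primrec_casesOn (α := α × (ℕ × LambdaTerm) × List σ)
      (V := fun p i => some (V p.1 (p.2.1.1, i)))
      (A := fun p q => some (A p.1 (q, p.2.2.headI, p.2.2.tail.headI)))
      (L := fun p _ => some (L p.1 p.2.2.headI))
      (Primrec.snd.comp (Primrec.fst.comp .snd)) ?_ ?_ ?_
    · exact Primrec.option_some.comp (hV.comp (Primrec.fst.comp .fst)
        ((Primrec.fst.comp (Primrec.fst.comp (Primrec.snd.comp .fst))).pair .snd))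
    · have h : Primrec fun p : (α × (ℕ × LambdaTerm) × List σ) × LambdaTerm × LambdaTerm =>
          p.1.2.2 := Primrec.snd.comp (Primrec.snd.comp .fst)
      exact Primrec.option_some.comp (hA.comp (Primrec.fst.comp .fst) (Primrec.snd.pair
        ((Primrec.list_headI.comp h).pair (Primrec.list_headI.comp (Primrec.list_tail.comp h)))))
    · exact Primrec.option_some.comp (hL.comp (Primrec.fst.comp .fst)
        (Primrec.list_headI.comp (Primrec.snd.comp (Primrec.snd.comp .fst))))
  · rintro a ⟨k, t⟩ b hb
    cases t with
    | var i => simp at hb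
    | app u v =>
      simp only [List.mem_cons, List.not_mem_nil, or_false] at hb
      rcases hb with rfl | rfl
      · exact code_lt_app_left u v
      · exact code_lt_app_right u v
    | lam u =>
      simp only [List.mem_cons, List.not_mem_nil, or_false] at hb
      subst hb
      exact code_lt_lam u
  · rintro a ⟨k, t⟩
    cases t with
    | var i => simp [hvar]
    | app u v => simp [happ]
    | lam u => simp [hlam]

end Primrec

/-- `rename` and `subst` take a function as argument and so are not themselves candidates for
primitive recursion. An explicit form of the map lifted `j` times lets the depth `j` replace that
argument; `iterate_liftSubst` plays the same role for `inst`. -/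
theorem iterate_liftRen (k j i : ℕ) :
    liftRen^[j] (· + k) i = if i < j then i else i + k := by
  induction j generalizing i with
  | zero => simp
  | succ j ih =>
    rw [Function.iterate_succ_apply']
    cases i with
    | zero => simp [liftRen]
    | succ i =>
      simp only [liftRen, ih]
      split_ifs <;> omega

theorem primrec_shift : Primrec₂ fun k : ℕ => rename (· + k) := by
  have : Primrec₂ fun (k : ℕ) (p : ℕ × LambdaTerm) => rename (liftRen^[p.1] (· + k)) p.2 := by
    refine primrec_rec (V := fun k p => if p.2 < p.1 then var p.2 else var (p.2 + k))
      (A := fun _ p => app p.2.1 p.2.2) (L := fun _ u => lam u) ?_ ?_ ?_ ?_ ?_ ?_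
    · exact Primrec.ite (Primrec.nat_lt.comp (Primrec.snd.comp .snd) (Primrec.fst.comp .snd))
        (primrec_var.comp (Primrec.snd.comp .snd))
        (primrec_var.comp (Primrec.nat_add.comp (Primrec.snd.comp .snd) .fst))
    · exact primrec_app.comp (Primrec.fst.comp (Primrec.snd.comp .snd))
        (Primrec.snd.comp (Primrec.snd.comp .snd))
    · exact primrec_lam.comp .snd
    · intro k j i
      simp only [rename, iterate_liftRen]
      split_ifs <;> rfl
    · intros; rfl
    · intro k j u
      simp only [rename, Function.iterate_succ_apply']
  exact this.comp .fst ((Primrec.const 0).pair .snd)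

theorem iterate_liftSubst (v : LambdaTerm) (k i : ℕ) :
    liftSubst^[k] (instSubst v) i =
      if i < k then var i else if i = k then rename (· + k) v else var (i - 1) := by
  induction k generalizing i with
  | zero =>
    cases i with
    | zero =>
      simp only [Function.iterate_zero, id, instSubst, lt_irrefl, if_false, if_true]
      rw [rename_eq_subst]
      exact (subst_var v).symm
    | succ i => simp [instSubst]
  | succ k ih =>
    rw [Function.iterate_succ_apply']
    cases i with
    | zero => simp [liftSubst]
    | succ i =>
      simp only [liftSubst, ih]
      split_ifs <;> first | omega | rfl | skip
      · rw [rename_rename]; rfl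
      · simp only [rename]; congr 1; omega

theorem primrec_inst : Primrec₂ inst := by
  have : Primrec₂ fun (v : LambdaTerm) (p : ℕ × LambdaTerm) =>
      subst (liftSubst^[p.1] (instSubst v)) p.2 := by
    refine primrec_rec (V := fun v p => if p.2 < p.1 then var p.2 else
        if p.2 = p.1 then rename (· + p.1) v else var (p.2 - 1))
      (A := fun _ p => app p.2.1 p.2.2) (L := fun _ u => lam u) ?_ ?_ ?_ ?_ ?_ ?_
    · exact Primrec.ite (Primrec.nat_lt.comp (Primrec.snd.comp .snd) (Primrec.fst.comp .snd))
        (primrec_var.comp (Primrec.snd.comp .snd))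
        (Primrec.ite (Primrec.eq.comp (Primrec.snd.comp .snd) (Primrec.fst.comp .snd))
          (primrec_shift.comp (Primrec.fst.comp .snd) .fst)
          (primrec_var.comp (Primrec.pred.comp (Primrec.snd.comp .snd))))
    · exact primrec_app.comp (Primrec.fst.comp (Primrec.snd.comp .snd))
        (Primrec.snd.comp (Primrec.snd.comp .snd))
    · exact primrec_lam.comp .snd
    · intro v k i
      exact iterate_liftSubst v k i
    · intros; rfl
    · intro k j u
      simp only [subst, Function.iterate_succ_apply']
  exact this.comp .snd ((Primrec.const 0).pair .fst)

theorem primrec_unlam : Primrec unlam := by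
  refine (primrec_casesOn (V := fun a _ => a) (A := fun a _ => a) (L := fun _ u => u) .id
    .fst .fst .snd).of_eq fun t => ?_
  cases t <;> rfl

theorem primrec_isLam : PrimrecPred IsLam := by
  refine Primrec.primrecPred ((primrec_casesOn (V := fun _ _ => false) (A := fun _ _ => false)
    (L := fun _ _ => true) Primrec.id (.const _) (.const _) (.const _)).of_eq fun t => ?_)
  cases t <;> simp [IsLam]

theorem primrec_dev : Primrec dev := by
  have : Primrec₂ fun (_ : Unit) (p : ℕ × LambdaTerm) => dev p.2 := by
    refine primrec_rec (V := fun _ p => var p.2)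
      (A := fun _ p => if p.1.1.IsLam then inst (unlam p.2.1) p.2.2 else app p.2.1 p.2.2)
      (L := fun _ u => lam u) ?_ ?_ ?_ ?_ ?_ ?_
    · exact primrec_var.comp (Primrec.snd.comp .snd)
    · have h₁ : Primrec fun p : Unit × (LambdaTerm × LambdaTerm) × LambdaTerm × LambdaTerm =>
          p.2.2.1 := Primrec.fst.comp (Primrec.snd.comp .snd)
      have h₂ : Primrec fun p : Unit × (LambdaTerm × LambdaTerm) × LambdaTerm × LambdaTerm =>
          p.2.2.2 := Primrec.snd.comp (Primrec.snd.comp .snd)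
      exact Primrec.ite (primrec_isLam.comp (Primrec.fst.comp (Primrec.fst.comp .snd)))
        (primrec_inst.comp (primrec_unlam.comp h₁) h₂) (primrec_app.comp h₁ h₂)
    · exact primrec_lam.comp .snd
    · intros; rfl
    · intros; rfl
    · intros; rfl
  exact this.comp (.const ()) ((Primrec.const 0).pair .id)

theorem primrec_strip : Primrec strip := by
  -- The recursion scheme gives the abstraction case only the recursive value, not the body, so the
  -- term is carried along with its image.
  have : Primrec₂ fun (_ : Unit) (p : ℕ × LambdaTerm) => (strip p.2, p.2) := by
    refine primrec_rec (V := fun _ p => (var p.2, var p.2))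
      (A := fun _ p => (if p.1.1 = var 1 then p.1.2 else app p.2.1.1 p.1.2, app p.1.1 p.1.2))
      (L := fun _ u => (lam u.2, lam u.2)) ?_ ?_ ?_ ?_ ?_ ?_
    · have := primrec_var.comp (Primrec.snd.comp (Primrec.snd (α := Unit) (β := ℕ × ℕ)))
      exact this.pair this
    · have h₁ : Primrec fun p : Unit × (LambdaTerm × LambdaTerm) ×
          (LambdaTerm × LambdaTerm) × (LambdaTerm × LambdaTerm) => p.2.1.1 :=
        Primrec.fst.comp (Primrec.fst.comp .snd)
      have h₂ : Primrec fun p : Unit × (LambdaTerm × LambdaTerm) ×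
          (LambdaTerm × LambdaTerm) × (LambdaTerm × LambdaTerm) => p.2.1.2 :=
        Primrec.snd.comp (Primrec.fst.comp .snd)
      exact (Primrec.ite (Primrec.eq.comp h₁ (.const (var 1))) h₂ (primrec_app.comp
        (Primrec.fst.comp (Primrec.fst.comp (Primrec.snd.comp .snd))) h₂)).pair
        (primrec_app.comp h₁ h₂)
    · have := primrec_lam.comp (Primrec.snd.comp
        (Primrec.snd (α := Unit) (β := LambdaTerm × LambdaTerm)))
      exact this.pair this
    · intros; rfl
    · intros; rfl
    · intros; rfl
  exact Primrec.fst.comp (this.comp (.const ()) ((Primrec.const 0).pair .id))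

/-! ### Recursive enumerability -/

theorem _root_.REPred.and {α : Type*} [Primcodable α] {p q : α → Prop} (hp : REPred p)
    (hq : REPred q) : REPred fun a => p a ∧ q a := by
  refine (Partrec.dom_re (Partrec.bind hp (hq.comp Computable.fst).to₂)).of_eq fun a => ?_
  simp [Part.assert]

theorem rePred_exists {α : Type*} [Primcodable α] {f : α → ℕ → Bool} (hf : Computable₂ f) :
    REPred fun a => ∃ n, f a n = true := by
  refine (Partrec.dom_re (Partrec.rfind (p := fun a n => Part.some (f a n)) hf.partrec₂)).of_eq
    fun a => ?_
  exact Nat.rfind_dom'.trans (by simp)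

theorem computablePred_closed : ComputablePred Closed := by
  have : Primrec₂ fun (_ : Unit) (p : ℕ × LambdaTerm) =>
      (@decide (Below p.1 p.2) (Classical.dec _)) := by
    refine primrec_rec (V := fun _ p => decide (p.2 < p.1)) (A := fun _ p => p.2.1 && p.2.2)
      (L := fun _ b => b) ?_ ?_ ?_ ?_ ?_ ?_
    · exact (Primrec.nat_lt.comp (Primrec.snd.comp .snd) (Primrec.fst.comp .snd)).decide
    · exact Primrec.and.comp (Primrec.fst.comp (Primrec.snd.comp .snd))
        (Primrec.snd.comp (Primrec.snd.comp .snd))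
    · exact Primrec.snd
    · intros; exact decide_eq_decide.2 Iff.rfl
    · intros
      rw [Bool.eq_iff_iff, Bool.and_eq_true]
      simp only [decide_eq_true_iff]
      exact Iff.rfl
    · intros; rfl
  refine ComputablePred.computable_iff.2 ⟨_, (this.comp (.const ())
    ((Primrec.const 0).pair .id)).to_comp, ?_⟩
  funext t
  simp [closed_iff_below]

/-- Unbounded search for the number of iterations, each instance being a primitive recursive test;
closedness of `T` is decidable. -/
theorem rePred_isStorageOperatorFor {t : LambdaTerm} (ht : t.Closed) (htn : t.Normal) :
    REPred fun T => IsStorageOperatorFor T t := by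
  have hstart : Primrec fun T => symbolicStart T t :=
    primrec_app.comp (primrec_app.comp .id (.const _)) (.const _)
  have hf : Primrec₂ fun (T : LambdaTerm) (n : ℕ) =>
      decide ((strip ∘ dev)^[n] (symbolicStart T t) = app (var 0) t) :=
    (Primrec.eq.comp (Primrec.nat_iterate .snd (hstart.comp .fst)
      ((primrec_strip.comp primrec_dev).comp .snd).to₂) (.const _)).decide
  refine (computablePred_closed.to_re.and (rePred_exists hf.to_comp)).of_eq fun T => ?_
  rw [isStorageOperatorFor_iff ht htn, symbolicRed_iff htn]
  simp

theorem rePred_isStorageOperator {D : Set LambdaTerm} (hD : ∀ t ∈ D, t.Closed ∧ t.Normal)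
    (hfin : D.Finite) : REPred fun T => IsStorageOperator D T := by
  induction D, hfin using Set.Finite.induction_on with
  | empty =>
    refine computablePred_closed.to_re.of_eq fun T => ?_
    simp [IsStorageOperator]
  | insert _ _ ih =>
    have h := hD _ (Set.mem_insert _ _)
    refine ((rePred_isStorageOperatorFor h.1 h.2).and
      (ih fun t ht => hD t (Set.mem_insert_of_mem _ ht))).of_eq fun T => ?_
    simp only [IsStorageOperator, Set.forall_mem_insert]
    tauto

end LambdaTerm

/-! ### Encoding of computations and undecidability -/

namespace LambdaTerm

open Relation Turing.ToPartrec

/-! ### Computations by weak head reduction -/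

/-- Scott numerals. -/
def num : ℕ → LambdaTerm
  | 0 => lam (lam (var 1))
  | n + 1 => lam (lam (app (var 0) (num n)))

/-- Scott lists of Scott numerals. -/
def numList : List ℕ → LambdaTerm
  | [] => lam (lam (var 1))
  | n :: l => lam (lam (app (app (var 0) (num n)) (numList l)))

theorem num_closed (n : ℕ) : (num n).Closed := by
  rw [closed_iff_below]
  induction n with
  | zero => simp [num, Below]
  | succ n ih => exact ⟨by simp [Below], ih.mono (by omega)⟩

theorem numList_closed (l : List ℕ) : (numList l).Closed := by
  rw [closed_iff_below]
  induction l with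
  | nil => simp [numList, Below]
  | cons n l ih => exact ⟨⟨by simp [Below], (num_closed n).below _⟩, ih.mono (by omega)⟩

/-- The continuation that prepends the head of `l` to its argument and passes the result to `k`. -/
def contCons₂ (l k : LambdaTerm) : LambdaTerm :=
  lam (app (app (rename Nat.succ l)
    (app (rename Nat.succ k) (lam (lam (app (app (var 0) (num 0)) (var 2))))))
    (lam (lam (app (rename (· + 3) k) (lam (lam (app (app (var 0) (var 3)) (var 4))))))))

/-- The continuation that computes `f` on `l`, prepends the head of its argument to the result, and
passes this to `k`. -/
def contCons₁ (f l k : LambdaTerm) : LambdaTerm :=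
  lam (app (app f (contCons₂ (var 0) (rename Nat.succ k))) (rename Nat.succ l))

/-- The continuation that applies `f` to its argument, and passes the result to `k`. -/
def contComp (f k : LambdaTerm) : LambdaTerm := lam (app (app f (rename Nat.succ k)) (var 0))

/-- The half of `contFix`. -/
def contFixHalf (f k : LambdaTerm) : LambdaTerm :=
  lam (lam (app (app (var 0) (app (rename (· + 2) k) (numList [])))
    (lam (lam (app (app (var 1) (app (rename (· + 4) k) (var 0)))
      (lam (app (app f (app (var 4) (var 4))) (var 1))))))))

/-- The continuation that passes the tail of its argument to `k` if its head is zero, and otherwise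
applies `f` to the tail and starts again with the result. -/
def contFix (f k : LambdaTerm) : LambdaTerm := app (contFixHalf f k) (contFixHalf f k)

/-- The translation of codes: terms expecting a continuation and a list. -/
def ofCodeTerm : Code → LambdaTerm
  | .zero' => lam (lam (app (var 1) (lam (lam (app (app (var 0) (num 0)) (var 2))))))
  -- The head of the empty list is `0` by default, so the result on the empty list is `[1]`.
  | .succ => lam (lam (app (app (var 0) (app (var 1) (numList [1])))
      (lam (lam (app (var 3) (lam (lam (app (app (var 0) (lam (lam (app (var 0) (var 5)))))
        (numList [])))))))))
  | .tail => lam (lam (app (app (var 0) (app (var 1) (numList [])))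
      (lam (lam (app (var 3) (var 0))))))
  | .cons f g => lam (lam (app (app (ofCodeTerm f)
      (contCons₁ (ofCodeTerm g) (var 0) (var 1))) (var 0)))
  | .comp f g => lam (lam (app (app (ofCodeTerm g) (contComp (ofCodeTerm f) (var 1))) (var 0)))
  | .case f g => lam (lam (app (app (var 0) (app (app (ofCodeTerm f) (var 1)) (numList [])))
      (lam (lam (app (app (var 1) (app (app (ofCodeTerm f) (var 3)) (var 0)))
        (lam (app (app (ofCodeTerm g) (var 4))
          (lam (lam (app (app (var 0) (var 2)) (var 3)))))))))))
  | .fix f => lam (lam (app (app (ofCodeTerm f) (contFix (ofCodeTerm f) (var 1))) (var 0)))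

/-- The translation of continuations. -/
def ofCont : Cont → LambdaTerm
  -- The output is discarded: every halting computation yields the identity.
  | .halt => lam (lam (var 0))
  | .cons₁ f l k => contCons₁ (ofCodeTerm f) (numList l) (ofCont k)
  | .cons₂ l k => contCons₂ (numList l) (ofCont k)
  | .comp f k => contComp (ofCodeTerm f) (ofCont k)
  | .fix f k => contFix (ofCodeTerm f) (ofCont k)

/-- The translation of configurations. -/
def ofCfg : Cfg → LambdaTerm
  | .halt _ => lam (var 0)
  | .ret k l => app (ofCont k) (numList l)

theorem ofCodeTerm_closed (c : Code) : (ofCodeTerm c).Closed := by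
  rw [closed_iff_below]
  induction c with
  | zero' => simp [ofCodeTerm, Below, (num_closed _).below]
  | succ => simp [ofCodeTerm, Below, (numList_closed _).below]
  | tail => simp [ofCodeTerm, Below, (numList_closed _).below]
  | cons f g ihf ihg =>
    simp [ofCodeTerm, Below, contCons₁, contCons₂, rename, (num_closed _).below, ihf.mono, ihg.mono]
  | comp f g ihf ihg => simp [ofCodeTerm, Below, contComp, rename, ihf.mono, ihg.mono]
  | case f g ihf ihg =>
    simp [ofCodeTerm, Below, (numList_closed _).below, ihf.mono, ihg.mono]
  | fix f ih =>
    simp [ofCodeTerm, Below, contFix, contFixHalf, rename, (numList_closed _).below, ih.mono]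

theorem ofCont_closed (k : Cont) : (ofCont k).Closed := by
  induction k with
  | halt => simp [closed_iff_below, ofCont, Below]
  | cons₁ f l k ih =>
    simp [closed_iff_below, ofCont, contCons₁, contCons₂, Below, rename, (num_closed _).below,
      (ofCodeTerm_closed _).below, (numList_closed _).below, (numList_closed _).rename_eq,
      ih.rename_eq, ih.below]
  | cons₂ l k ih =>
    simp [closed_iff_below, ofCont, contCons₂, Below, (num_closed _).below,
      (numList_closed _).below, (numList_closed _).rename_eq, ih.rename_eq, ih.below]
  | comp f k ih =>
    simp [closed_iff_below, ofCont, contComp, Below, (ofCodeTerm_closed _).below,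
      ih.rename_eq, ih.below]
  | fix f k ih =>
    simp [closed_iff_below, ofCont, contFix, contFixHalf, Below, (ofCodeTerm_closed _).below,
      (numList_closed _).below, ih.rename_eq, ih.below]

/-- One or more steps of weak head reduction. -/
abbrev WhTrans : LambdaTerm → LambdaTerm → Prop := TransGen WhStep

theorem WhTrans.appL {u v : LambdaTerm} (h : WhTrans u v) (w : LambdaTerm) :
    WhTrans (app u w) (app v w) := by
  induction h with
  | single h => exact .single (.appL w h)
  | tail _ h ih => exact ih.tail (.appL w h)

theorem WhTrans.beta {u v w : LambdaTerm} (h : inst u v = w) : WhTrans (app (lam u) v) w :=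
  h ▸ .single (.beta u v)

theorem whTrans_beta₂ {u v v' w : LambdaTerm}
    (h : inst (subst (liftSubst (instSubst v)) u) v' = w) :
    WhTrans (app (app (lam (lam u)) v) v') w :=
  ((WhTrans.beta (u := lam u) rfl).appL v').trans (WhTrans.beta h)

theorem whTrans_num_zero (a b : LambdaTerm) : WhTrans (app (app (num 0) a) b) a :=
  whTrans_beta₂ (inst_rename_succ a b)

theorem whTrans_num_succ (n : ℕ) (a b : LambdaTerm) :
    WhTrans (app (app (num (n + 1)) a) b) (app b (num n)) :=
  whTrans_beta₂ (by simp [inst, subst, liftSubst, instSubst, (num_closed n).subst_eq])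

theorem whTrans_numList_nil (a b : LambdaTerm) : WhTrans (app (app (numList []) a) b) a :=
  whTrans_beta₂ (inst_rename_succ a b)

theorem whTrans_numList_cons (n : ℕ) (l : List ℕ) (a b : LambdaTerm) :
    WhTrans (app (app (numList (n :: l)) a) b) (app (app b (num n)) (numList l)) :=
  whTrans_beta₂ (by simp [inst, subst, liftSubst, instSubst, (num_closed n).subst_eq,
    (numList_closed l).subst_eq])

section

attribute [local simp] inst subst rename liftSubst instSubst liftRen

set_option linter.unusedSimpArgs false in
-- Continuation passing keeps the control in head position, so the evaluator is simulated by weak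
-- head reduction alone. The number of steps is positive, which is what turns divergence into an
-- infinite reduction.
theorem whTrans_stepNormal (c : Code) (k : Cont) (l : List ℕ) :
    WhTrans (app (app (ofCodeTerm c) (ofCont k)) (numList l)) (ofCfg (stepNormal c k l)) := by
  have hn := fun n σ => (num_closed n).subst_eq σ
  have hl := fun n σ => (numList_closed n).subst_eq σ
  have hl' := fun n σ => (numList_closed n).rename_eq σ
  have hc := fun n σ => (ofCodeTerm_closed n).subst_eq σ
  have hk := fun n σ => (ofCont_closed n).subst_eq σ
  have hk' := fun n σ => (ofCont_closed n).rename_eq σ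
  induction c generalizing k l with
  | zero' =>
    refine whTrans_beta₂ ?_
    simp [hn, hk, hk', hl, hl', stepNormal, ofCfg, numList]
  | succ =>
    refine (whTrans_beta₂ rfl).trans ?_
    simp only [inst, subst, liftSubst, instSubst, hl, hk, hk', hl', rename]
    cases l with
    | nil => exact whTrans_numList_nil _ _
    | cons n l =>
      refine (whTrans_numList_cons _ _ _ _).trans (whTrans_beta₂ ?_)
      have hn' := fun n σ => (num_closed n).rename_eq σ
      simp [hn, hn', hk, hk', hl, hl', stepNormal, ofCfg, numList, num]
  | tail =>
    refine (whTrans_beta₂ rfl).trans ?_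
    simp only [inst, subst, liftSubst, instSubst, hl, hk, hk', hl', rename]
    cases l with
    | nil => exact whTrans_numList_nil _ _
    | cons n l =>
      refine (whTrans_numList_cons _ _ _ _).trans (whTrans_beta₂ ?_)
      simp [hk, hk', hl, stepNormal, ofCfg]
  | cons f g ihf _ =>
    refine (whTrans_beta₂ ?_).trans (ihf _ l)
    simp [ofCont, contCons₁, contCons₂, hn, hk, hk', hl, hl', hc]
  | comp f g _ ihg =>
    refine (whTrans_beta₂ ?_).trans (ihg _ l)
    simp [ofCont, contComp, hk, hk', hl, hc]
  | case f g ihf ihg =>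
    refine (whTrans_beta₂ rfl).trans ?_
    simp only [inst, subst, liftSubst, instSubst, hl, hk, hk', hl', hc, rename]
    cases l with
    | nil => exact (whTrans_numList_nil _ _).trans (ihf k [])
    | cons n l =>
      refine (whTrans_numList_cons _ _ _ _).trans ((whTrans_beta₂ rfl).trans ?_)
      have hn' := fun n σ => (num_closed n).rename_eq σ
      simp only [inst, subst, liftSubst, instSubst, hl, hk, hk', hl', hc, hn, hn', rename]
      cases n with
      | zero => exact (whTrans_num_zero _ _).trans (ihf k l)
      | succ n =>
        refine (whTrans_num_succ _ _ _).trans ((WhTrans.beta ?_).trans (ihg k (n :: l)))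
        simp [hk, hl, hc, hn, hn', hl', numList]
  | fix f ih =>
    refine (whTrans_beta₂ ?_).trans (ih _ l)
    simp [ofCont, contFix, contFixHalf, hk, hk', hl, hc]

set_option linter.unusedSimpArgs false in
theorem whTrans_stepRet (k : Cont) (l : List ℕ) :
    WhTrans (app (ofCont k) (numList l)) (ofCfg (stepRet k l)) := by
  have hn := fun n σ => (num_closed n).subst_eq σ
  have hn' := fun n σ => (num_closed n).rename_eq σ
  have hl := fun n σ => (numList_closed n).subst_eq σ
  have hl' := fun n σ => (numList_closed n).rename_eq σ
  have hc := fun n σ => (ofCodeTerm_closed n).subst_eq σ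
  have hc' := fun n σ => (ofCodeTerm_closed n).rename_eq σ
  have hk := fun n σ => (ofCont_closed n).subst_eq σ
  have hk' := fun n σ => (ofCont_closed n).rename_eq σ
  induction k generalizing l with
  | halt => exact WhTrans.beta rfl
  | cons₁ f m k ih =>
    refine (WhTrans.beta ?_).trans (whTrans_stepNormal f _ m)
    simp [ofCont, contCons₂, hn, hk, hk', hl, hl', hc]
  | cons₂ m k ih =>
    refine (WhTrans.beta rfl).trans ?_
    simp only [inst, subst, liftSubst, instSubst, hl, hk, hk', hl', hn, hn', rename]
    cases m with
    | nil => exact (whTrans_numList_nil _ _).trans (ih (0 :: l))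
    | cons n m =>
      refine (whTrans_numList_cons _ _ _ _).trans ((whTrans_beta₂ ?_).trans (ih (n :: l)))
      simp [hn, hn', hk, hk', hl, hl', numList]
  | comp f k ih =>
    refine (WhTrans.beta ?_).trans (whTrans_stepNormal f k l)
    simp [hk, hk', hc]
  | fix f k ih =>
    refine (whTrans_beta₂ rfl).trans ?_
    simp only [inst, subst, liftSubst, instSubst, hl, hk, hk', hl', hc, rename]
    cases l with
    | nil => exact (whTrans_numList_nil _ _).trans (ih [])
    | cons n l =>
      refine (whTrans_numList_cons _ _ _ _).trans ((whTrans_beta₂ rfl).trans ?_)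
      simp only [inst, subst, liftSubst, instSubst, hl, hk, hk', hl', hc, hn, hn', rename]
      cases n with
      | zero => exact (whTrans_num_zero _ _).trans (ih l)
      | succ n =>
        refine (whTrans_num_succ _ _ _).trans ((WhTrans.beta ?_).trans (whTrans_stepNormal f _ l))
        simp [ofCont, contFix, contFixHalf, hk, hk', hl, hl', hc, hc']

end

theorem whTrans_step {x y : Cfg} (h : y ∈ step x) : WhTrans (ofCfg x) (ofCfg y) := by
  cases x with
  | halt => cases h
  | ret k l =>
    cases h
    exact whTrans_stepRet k l

theorem WhTrans.steps {u v : LambdaTerm} (h : WhTrans u v) : ∃ k, Steps WhStep (k + 1) u v := by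
  obtain ⟨w, hw, h⟩ := TransGen.head'_iff.1 h
  obtain ⟨k, hk⟩ := exists_steps h
  exact ⟨k, w, hw, hk⟩

theorem betaEq_of_reaches {x y : Cfg} (h : StateTransition.Reaches step x y) :
    BetaEq (ofCfg x) (ofCfg y) := by
  induction h with
  | refl => exact .refl _
  | tail _ h ih =>
    obtain ⟨k, hk⟩ := (whTrans_step h).steps
    exact ih.trans hk.betaEq

/-- A computation that does not halt gives rise to an infinite weak head reduction. -/
theorem not_steps_of_not_dom {x : Cfg} (h : ¬ (StateTransition.eval step x).Dom)
    (l : List LambdaTerm) {k : ℕ} {v : LambdaTerm} (hv : ∀ w, ¬ WhStep v w) :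
    ¬ Steps WhStep k (apps (ofCfg x) l) v := by
  induction k using Nat.strong_induction_on generalizing x with
  | _ k ih =>
  intro hk
  cases hx : step x with
  | none => exact h (Part.dom_iff_mem.2 ⟨x, StateTransition.mem_eval.2 ⟨.refl, hx⟩⟩)
  | some y =>
    obtain ⟨j, hj⟩ := (whTrans_step hx).steps
    obtain ⟨i, rfl, hi⟩ := (hj.apps l).split hk hv
    refine ih i (by omega) (fun hy => h ?_) hi
    rwa [StateTransition.reaches_eval (.single hx)]

/-- There is a primitive recursive family of closed terms, among which it is undecidable which ones
are β-equivalent to the identity, while the other ones have infinite weak head reductions. -/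
theorem exists_undecidable_family : ∃ (p : ℕ → Prop) (F : ℕ → LambdaTerm),
    ¬ ComputablePred p ∧ Primrec F ∧ (∀ n, (F n).Closed) ∧ (∀ n, p n → BetaEq (F n) (lam (var 0))) ∧
    ∀ n, ¬ p n → ∀ l k v, (∀ w, ¬ WhStep v w) → ¬ Steps WhStep k (apps (F n) l) v := by
  -- The domain of `f` is the halting problem on input `0`.
  let f : ℕ →. ℕ := fun n => Nat.Partrec.Code.eval (Denumerable.ofNat Nat.Partrec.Code n) 0
  have hf : Partrec f :=
    Nat.Partrec.Code.eval_part.comp (Computable.ofNat _) (Computable.const 0)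
  obtain ⟨c, hc⟩ := Code.exists_code (Nat.Partrec'.part_iff₁.2 hf)
  have hdom : ∀ n, (StateTransition.eval step (stepNormal c .halt [n])).Dom ↔ (f n).Dom := by
    intro n
    have := hc ⟨[n], rfl⟩
    rw [stepNormal_eval]
    change c.eval [n] = _ at this
    rw [this]
    rfl
  refine ⟨fun n => (f n).Dom, fun n => app (app (ofCodeTerm c) (ofCont .halt)) (numList [n]),
    fun h => ?_, ?_, fun n => ?_, fun n hn => ?_, fun n hn l k v hv hk => ?_⟩
  · refine ComputablePred.halting_problem 0 ?_
    obtain ⟨g, hg, hfg⟩ := ComputablePred.computable_iff.1 h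
    refine ComputablePred.computable_iff.2 ⟨_, hg.comp Computable.encode, ?_⟩
    funext c
    have := congrFun hfg (Encodable.encode c)
    simpa [f] using this
  · have hnum : Primrec num := by
      refine (Primrec.nat_rec₁ (f := fun _ u => lam (lam (app (var 0) u))) (num 0)
        (primrec_lam.comp (primrec_lam.comp (primrec_app.comp (.const _) .snd)))).of_eq fun n => ?_
      induction n with
      | zero => rfl
      | succ n ih => exact congrArg (fun u => lam (lam (app (var 0) u))) ih
    exact primrec_app.comp (.const _) (primrec_lam.comp (primrec_lam.comp (primrec_app.comp
      (primrec_app.comp (.const _) hnum) (.const _))))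
  · exact ((ofCodeTerm_closed c).app (ofCont_closed _)).app (numList_closed _)
  · obtain ⟨y, hy⟩ := Part.dom_iff_mem.1 ((hdom n).2 hn)
    obtain ⟨j, hj⟩ := (whTrans_stepNormal c .halt [n]).steps
    refine hj.betaEq.trans ?_
    obtain ⟨hr, hy⟩ := StateTransition.mem_eval.1 hy
    have := betaEq_of_reaches hr
    cases y with
    | halt => exact this
    | ret => cases hy
  · obtain ⟨j, hj⟩ := (whTrans_stepNormal c .halt [n]).steps
    obtain ⟨i, -, hi⟩ := (hj.apps l).split hk hv
    exact not_steps_of_not_dom (fun h => hn ((hdom n).1 h)) l hv hi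

/-- The map `n ↦ (F n)T` reduces an undecidable predicate to the set in question: `(F n)T ≃ T` when
`p n` holds, and otherwise no head reduction starting from `(F n)T` can reach `(f)σ(τ)`. -/
theorem not_computablePred_isStorageOperator {D : Set LambdaTerm}
    (hD : ∀ t ∈ D, t.Closed ∧ t.Normal) (hne : D.Nonempty) (hT : ∃ T, IsStorageOperator D T) :
    ¬ ComputablePred fun T => IsStorageOperator D T := by
  obtain ⟨t, ht⟩ := hne
  obtain ⟨T, hT⟩ := hT
  obtain ⟨p, F, hp, hF, hcl, hpos, hneg⟩ := exists_undecidable_family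
  refine fun h => hp ?_
  obtain ⟨g, hg, hDg⟩ := ComputablePred.computable_iff.1 h
  refine ComputablePred.computable_iff.2
    ⟨_, hg.comp (primrec_app.comp hF (.const T)).to_comp, ?_⟩
  funext n
  have hn := congrFun hDg (app (F n) T)
  change p n = (g (app (F n) T) : Prop)
  rw [← hn]
  refine propext ⟨fun h => hT.of_betaEq hD ((hcl n).app hT.1) ?_, fun h => ?_⟩
  · exact ((hpos n h).app (.refl T)).trans (BetaEq.beta _ _)
  · by_contra hpn
    obtain ⟨-, τ, -, hτ⟩ := h.2 t ht
    obtain ⟨σ, hσ⟩ := hτ t (.refl t) 0 (by have := (hD t ht).1; rw [Closed] at this; simp [this])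
    obtain ⟨k, hk⟩ := hσ.steps (by rintro ⟨_, h⟩; cases h)
    -- Here `F n` stands in head position with the three arguments `T`, `t` and `f`.
    exact hneg n hpn [T, t, var 0] k _ (apps_var_not_whStep 0 [_]) hk

end LambdaTerm

/-! ### Separation of normal terms up to η and existence of storage operators -/

namespace LambdaTerm

open Relation

/-! ### η-equivalence of normal terms -/

/-- η-equivalence. -/
def EtaEq : LambdaTerm → LambdaTerm → Prop := EqvGen EtaStep

theorem EtaEq.lift {F : LambdaTerm → LambdaTerm} (hF : ∀ u v, EtaStep u v → EtaStep (F u) (F v))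
    {u v : LambdaTerm} (h : EtaEq u v) : EtaEq (F u) (F v) := by
  induction h with
  | rel _ _ h => exact .rel _ _ (hF _ _ h)
  | refl => exact .refl _
  | symm _ _ _ ih => exact .symm _ _ ih
  | trans _ _ _ _ _ ih ih' => exact .trans _ _ _ ih ih'

theorem EtaEq.app {u u' v v' : LambdaTerm} (hu : EtaEq u u') (hv : EtaEq v v') :
    EtaEq (app u v) (app u' v') :=
  .trans _ _ _ (EtaEq.lift (F := fun x => LambdaTerm.app x v) (fun _ _ h => .appL v h) hu)
    (EtaEq.lift (F := fun x => LambdaTerm.app u' x) (fun _ _ h => .appR u' h) hv)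

theorem EtaEq.lam {u u' : LambdaTerm} (hu : EtaEq u u') : EtaEq (lam u) (lam u') :=
  EtaEq.lift (F := LambdaTerm.lam) (fun _ _ h => .lam h) hu

theorem EtaEq.apps {u u' : LambdaTerm} (hu : EtaEq u u') {l l' : List LambdaTerm}
    (hl : List.Forall₂ EtaEq l l') : EtaEq (apps u l) (apps u' l') := by
  induction hl generalizing u u' with
  | nil => exact hu
  | cons h _ ih => exact ih (hu.app h)

theorem rename_id (t : LambdaTerm) : rename id t = t := by
  rw [rename_eq_subst]; exact subst_var t

theorem rename_succ_injective : Function.Injective (rename Nat.succ) := by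
  intro u v h
  have := congrArg (rename Nat.pred) h
  rw [rename_rename, rename_rename] at this
  rwa [show Nat.pred ∘ Nat.succ = id from rfl, rename_id, rename_id] at this

theorem mem_fv_rename {ρ : ℕ → ℕ} {t : LambdaTerm} {i : ℕ} (hi : i ∈ Fv t) :
    ρ i ∈ Fv (rename ρ t) := by
  induction t generalizing ρ i with
  | var j => cases hi; rfl
  | app u v ihu ihv => exact hi.imp ihu ihv
  | lam u ih => exact ih (ρ := liftRen ρ) (i := i + 1) hi

theorem mem_fv_rename_succ {t : LambdaTerm} {i : ℕ} (hi : i ∈ Fv (rename Nat.succ t)) :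
    i ≠ 0 := by
  rintro rfl
  have h : ∀ n (t : LambdaTerm) (ρ : ℕ → ℕ), (∀ i, ρ i ≠ n) → n ∉ Fv (rename ρ t) := by
    intro n t
    induction t generalizing n with
    | var j => intro ρ hρ h; exact hρ j h.symm
    | app u v ihu ihv => exact fun ρ hρ h => h.elim (ihu n ρ hρ) (ihv n ρ hρ)
    | lam u ih =>
      intro ρ hρ h
      refine ih (n + 1) (liftRen ρ) (fun i => ?_) h
      cases i with
      | zero => exact (Nat.succ_ne_zero n).symm
      | succ i => exact fun h => hρ i (Nat.succ.inj h)
  exact h 0 t Nat.succ Nat.succ_ne_zero hi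

theorem eq_rename_succ_of_rename_liftRen {ρ : ℕ → ℕ} {p w : LambdaTerm}
    (h : rename (liftRen ρ) p = rename Nat.succ w) :
    ∃ p', p = rename Nat.succ p' ∧ w = rename ρ p' := by
  have hp : p = rename Nat.succ (rename Nat.pred p) := by
    rw [rename_rename, rename_eq_subst]
    conv_lhs => rw [← subst_var p]
    refine subst_congr fun i hi => ?_
    have : i ≠ 0 := by
      rintro rfl
      have h0 := mem_fv_rename (ρ := liftRen ρ) hi
      rw [h] at h0
      exact mem_fv_rename_succ h0 rfl
    obtain ⟨i, rfl⟩ := Nat.exists_eq_succ_of_ne_zero this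
    rfl
  refine ⟨_, hp, rename_succ_injective ?_⟩
  rw [← h, rename_rename]
  conv_lhs => rw [hp, rename_rename]
  rfl

/-- A lifted renaming sends only `0` to `0`, so renaming creates neither the variable nor the
freshness condition of an η-redex. -/
theorem EtaStep.of_rename {ρ : ℕ → ℕ} {u w : LambdaTerm} (h : EtaStep (rename ρ u) w) :
    ∃ u', w = rename ρ u' ∧ EtaStep u u' := by
  induction u generalizing ρ w with
  | var i => cases h
  | app u v ihu ihv =>
    cases h with
    | appL _ h =>
      obtain ⟨u', rfl, hu⟩ := ihu h
      exact ⟨_, rfl, .appL v hu⟩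
    | appR _ h =>
      obtain ⟨v', rfl, hv⟩ := ihv h
      exact ⟨_, rfl, .appR u hv⟩
  | lam u ih =>
    rw [rename] at h
    generalize hx : rename (liftRen ρ) u = x at h
    cases h with
    | lam h =>
      subst hx
      obtain ⟨u', rfl, hu⟩ := ih h
      exact ⟨_, rfl, .lam hu⟩
    | eta =>
      cases u with
      | var => cases hx
      | lam => cases hx
      | app p q =>
        injection hx with hp hq
        obtain ⟨p', rfl, rfl⟩ := eq_rename_succ_of_rename_liftRen hp
        cases q with
        | app => cases hq
        | lam => cases hq
        | var i =>
          cases i with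
          | succ i => simp [rename, liftRen] at hq
          | zero => exact ⟨p', rfl, .eta p'⟩

/-- η-reduction duplicates nothing, so two different reducts meet again after one step on each side.
-/
theorem EtaStep.diamond {a b c : LambdaTerm} (hb : EtaStep a b) (hc : EtaStep a c) :
    b = c ∨ ∃ d, EtaStep b d ∧ EtaStep c d := by
  have key : ∀ {u w}, EtaStep (LambdaTerm.app (LambdaTerm.rename Nat.succ u) (var 0)) w →
      ∃ d, EtaStep u d ∧ w = LambdaTerm.app (LambdaTerm.rename Nat.succ d) (var 0) := by
    intro u w h
    cases h with
    | appL _ h =>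
      obtain ⟨u', rfl, hu⟩ := h.of_rename
      exact ⟨u', hu, rfl⟩
    | appR _ h => cases h
  induction hb generalizing c with
  | eta u =>
    generalize hx : LambdaTerm.app (LambdaTerm.rename Nat.succ u) (var 0) = x at hc
    cases hc with
    | eta v =>
      injection hx with hx _
      exact .inl (rename_succ_injective hx)
    | lam h =>
      subst hx
      obtain ⟨d, hd, rfl⟩ := key h
      exact .inr ⟨d, hd, .eta d⟩
  | @appL u u' v hu ih =>
    cases hc with
    | appL _ hc =>
      rcases ih hc with rfl | ⟨d, hd, hd'⟩
      · exact .inl rfl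
      · exact .inr ⟨_, .appL v hd, .appL v hd'⟩
    | appR _ hc => exact .inr ⟨_, .appR _ hc, .appL _ hu⟩
  | @appR u v v' hv ih =>
    cases hc with
    | appL _ hc => exact .inr ⟨_, .appL _ hc, .appR _ hv⟩
    | appR _ hc =>
      rcases ih hc with rfl | ⟨d, hd, hd'⟩
      · exact .inl rfl
      · exact .inr ⟨_, .appR u hd, .appR u hd'⟩
  | @lam u u' hu ih =>
    cases hc with
    | eta v =>
      obtain ⟨d, hd, rfl⟩ := key hu
      exact .inr ⟨d, .eta d, hd⟩
    | lam hc =>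
      rcases ih hc with rfl | ⟨d, hd, hd'⟩
      · exact .inl rfl
      · exact .inr ⟨_, .lam hd, .lam hd'⟩

theorem EtaEq.join {u v : LambdaTerm} (h : EtaEq u v) : Join (ReflTransGen EtaStep) u v := by
  have key : ∀ a b c, ReflTransGen EtaStep a b → ReflTransGen EtaStep a c →
      Join (ReflTransGen EtaStep) b c := fun a b c hb hc => by
    refine Relation.church_rosser (fun a b c hb hc => ?_) hb hc
    rcases hb.diamond hc with rfl | ⟨d, hd, hd'⟩
    · exact ⟨b, .refl, .refl⟩
    · exact ⟨d, .single hd, .single hd'⟩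
  induction h with
  | rel _ _ h => exact ⟨_, .single h, .refl⟩
  | refl => exact ⟨_, .refl, .refl⟩
  | symm _ _ _ ih => obtain ⟨w, h, h'⟩ := ih; exact ⟨w, h', h⟩
  | trans _ _ _ _ _ ih ih' =>
    obtain ⟨w, h1, h2⟩ := ih
    obtain ⟨w', h1', h2'⟩ := ih'
    obtain ⟨z, hz, hz'⟩ := key _ _ _ h2 h1'
    exact ⟨z, h1.trans hz, h2'.trans hz'⟩

theorem EtaStep.isLam {u v : LambdaTerm} (h : EtaStep u v) (hv : v.IsLam) : u.IsLam := by
  obtain ⟨v, rfl⟩ := hv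
  cases h <;> exact ⟨_, rfl⟩

/-- Used contrapositively: η-reduction preserves β-normality, so a βη-reduction of a β-normal term
uses η-steps only. A term that η-reduces to an abstraction is already one, hence an application that
becomes a β-redex was one before. -/
theorem EtaStep.exists_betaStep {t u u' : LambdaTerm} (h : EtaStep t u) (hu : BetaStep u u') :
    ∃ t', BetaStep t t' := by
  induction h generalizing u' with
  | eta u =>
    refine ⟨_, .lam (.appL _ (u' := LambdaTerm.rename Nat.succ u') ?_)⟩
    simp only [rename_eq_subst]
    exact hu.subst _
  | appL v h ih =>
    cases hu with
    | beta a _ =>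
      obtain ⟨b, rfl⟩ := h.isLam ⟨a, rfl⟩
      exact ⟨_, .beta b v⟩
    | appL _ hu =>
      obtain ⟨t', ht⟩ := ih hu
      exact ⟨_, .appL _ ht⟩
    | appR _ hu => exact ⟨_, .appR _ hu⟩
  | appR u h ih =>
    cases hu with
    | beta a _ => exact ⟨_, .beta a _⟩
    | appL _ hu => exact ⟨_, .appL _ hu⟩
    | appR _ hu =>
      obtain ⟨t', ht⟩ := ih hu
      exact ⟨_, .appR _ ht⟩
  | lam h ih =>
    cases hu with
    | lam hu =>
      obtain ⟨t', ht⟩ := ih hu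
      exact ⟨_, .lam ht⟩

theorem IsBetaEtaNormalForm.etaRed {t u : LambdaTerm} (h : IsBetaEtaNormalForm t u)
    (ht : t.Normal) : ReflTransGen EtaStep t u := by
  suffices ReflTransGen EtaStep t u ∧ u.Normal from this.1
  obtain ⟨h, -⟩ := h
  induction h with
  | refl => exact ⟨.refl, ht⟩
  | tail _ h ih =>
    rcases h with h | h
    · exact absurd h (ih.2 _)
    · refine ⟨ih.1.tail h, fun w hw => ?_⟩
      obtain ⟨t', ht'⟩ := h.exists_betaStep hw
      exact ih.2 _ ht'

/-- η-equivalent β-normal terms have the same βη-normal form. -/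
theorem EtaEq.eq_of_isBetaEtaNormalForm {t s t' s' : LambdaTerm} (h : EtaEq t s) (ht : t.Normal)
    (hs : s.Normal) (ht' : IsBetaEtaNormalForm t t') (hs' : IsBetaEtaNormalForm s s') :
    t' = s' := by
  have red : ∀ {a b}, ReflTransGen EtaStep a b → EtaEq a b := fun h => by
    induction h with
    | refl => exact .refl _
    | tail _ h ih => exact .trans _ _ _ ih (.rel _ _ h)
  have eq_of_red : ∀ {a b w}, IsBetaEtaNormalForm a b → ReflTransGen EtaStep b w → w = b := by
    intro a b w hab h
    obtain rfl | ⟨v, hv, -⟩ := ReflTransGen.cases_head h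
    · rfl
    · exact absurd (.inr hv) (hab.2 v)
  obtain ⟨w, h₁, h₂⟩ := EtaEq.join (EqvGen.trans _ _ _ (EqvGen.symm _ _ (red (ht'.etaRed ht)))
    (EqvGen.trans _ _ _ h (red (hs'.etaRed hs))))
  rw [← eq_of_red ht' h₁, eq_of_red hs' h₂]

/-! ### Auxiliary combinators -/

theorem Below.apps {n : ℕ} {u : LambdaTerm} {l : List LambdaTerm} (hu : Below n u)
    (hl : ∀ v ∈ l, Below n v) : Below n (apps u l) := by
  induction l generalizing u with
  | nil => exact hu
  | cons v l ih =>
    exact ih ⟨hu, hl v List.mem_cons_self⟩ fun w hw => hl w (List.mem_cons_of_mem _ hw)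

/-- The function with `n` arguments and constant value `c`. -/
def konst : ℕ → LambdaTerm → LambdaTerm
  | 0, c => c
  | n + 1, c => lam (rename Nat.succ (konst n c))

theorem subst_konst (σ : ℕ → LambdaTerm) (n : ℕ) (c : LambdaTerm) :
    subst σ (konst n c) = konst n (subst σ c) := by
  induction n with
  | zero => rfl
  | succ n ih =>
    simp only [konst, subst]
    rw [← ih, subst_rename, rename_subst]
    rfl

theorem Below.konst {m n : ℕ} {c : LambdaTerm} (hc : Below m c) : Below m (konst n c) := by
  induction n with
  | zero => exact hc
  | succ n ih => exact ih.rename fun i hi => Nat.succ_lt_succ hi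

theorem konst_closed (n : ℕ) {c : LambdaTerm} (hc : c.Closed) : (konst n c).Closed :=
  closed_iff_below.2 (closed_iff_below.1 hc).konst

theorem betaEq_konst (c : LambdaTerm) (l : List LambdaTerm) :
    BetaEq (apps (konst l.length c) l) c := by
  induction l with
  | nil => exact .refl _
  | cons v l ih =>
    refine (BetaEq.apps_left ?_ l).trans ih
    have := BetaEq.beta (rename Nat.succ (konst l.length c)) v
    rwa [inst_rename_succ] at this

/-- The projection of `n` arguments on the argument number `i`. -/
def proj : ℕ → ℕ → LambdaTerm
  | 0, _ => lam (var 0)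
  | n + 1, 0 => lam (konst n (var 0))
  | n + 1, i + 1 => lam (proj n i)

theorem proj_closed (n i : ℕ) : (proj n i).Closed := by
  induction n generalizing i with
  | zero => simp [proj, closed_iff_below, Below]
  | succ n ih =>
    cases i with
    | zero => exact closed_iff_below.2 (Below.konst (m := 1) Nat.one_pos)
    | succ i => exact closed_iff_below.2 ((ih i).below 1)

theorem betaEq_proj (l : List LambdaTerm) (i : ℕ) (hi : i < l.length) :
    BetaEq (apps (proj l.length i) l) l[i] := by
  induction l generalizing i with
  | nil => cases hi
  | cons v l ih =>
    cases i with
    | zero =>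
      refine (BetaEq.apps_left ?_ l).trans (betaEq_konst v l)
      have := BetaEq.beta (konst l.length (var 0)) v
      rwa [inst, subst_konst] at this
    | succ i =>
      refine (BetaEq.apps_left ?_ l).trans (ih i (Nat.lt_of_succ_lt_succ hi))
      have := BetaEq.beta (proj l.length i) v
      rwa [inst, (proj_closed _ _).subst_eq] at this

/-- Any function on an initial segment of the numerals is definable. -/
theorem exists_betaEq_num (g : ℕ → LambdaTerm) (hg : ∀ i, (g i).Closed) (n : ℕ) :
    ∃ G : LambdaTerm, G.Closed ∧ ∀ i < n, BetaEq (app G (num i)) (g i) := by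
  induction n generalizing g with
  | zero => exact ⟨g 0, hg 0, fun i hi => absurd hi (Nat.not_lt_zero i)⟩
  | succ n ih =>
    obtain ⟨G, hG, h⟩ := ih (fun i => g (i + 1)) fun i => hg (i + 1)
    refine ⟨lam (app (app (var 0) (g 0)) G), ?_, fun i hi => ?_⟩
    · rw [closed_iff_below]
      exact ⟨⟨Nat.one_pos, (hg 0).below 1⟩, hG.below 1⟩
    · refine (BetaEq.beta _ _).trans ?_
      simp only [inst, subst, (hg 0).subst_eq, hG.subst_eq, instSubst]
      cases i with
      | zero =>
        obtain ⟨k, hk⟩ := (whTrans_num_zero (g 0) G).steps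
        exact hk.betaEq
      | succ i =>
        obtain ⟨k, hk⟩ := (whTrans_num_succ i (g 0) G).steps
        exact hk.betaEq.trans (h i (Nat.lt_of_succ_lt_succ hi))

/-- `(collect k h) x₁ … xₖ z` is β-equivalent to `(h) z x₁ … xₖ`. -/
def collect : ℕ → LambdaTerm → LambdaTerm
  | 0, h => h
  | k + 1, h => lam (collect k (lam (app (app (rename (· + 2) h) (var 0)) (var 1))))

theorem subst_collect (σ : ℕ → LambdaTerm) (k : ℕ) (h : LambdaTerm) :
    subst σ (collect k h) = collect k (subst σ h) := by
  induction k generalizing h σ with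
  | zero => rfl
  | succ k ih =>
    have : subst (liftSubst (liftSubst σ)) (rename (· + 2) h) = rename (· + 2) (subst σ h) := by
      rw [subst_rename, rename_subst]
      congr 1
      funext i
      simp only [Function.comp, liftSubst, rename_rename]
      rfl
    simp only [collect, subst, ih, this, liftSubst, rename]

theorem collect_below {n k : ℕ} {h : LambdaTerm} (hh : Below n h) : Below n (collect k h) := by
  induction k generalizing n h with
  | zero => exact hh
  | succ k ih =>
    refine ih (n := n + 1) ⟨⟨hh.rename fun i hi => ?_, ?_⟩, ?_⟩
    · omega
    · simp [Below]
    · simp [Below]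

/-- Each argument `x` is stored by passing from `h` to `λz (h) z x`, so `z` can be moved in front
without knowing it in advance. -/
theorem betaEq_collect (h z : LambdaTerm) (l : List LambdaTerm) :
    BetaEq (apps (collect l.length h) (l ++ [z])) (apps (app h z) l) := by
  induction l generalizing h with
  | nil => exact .refl _
  | cons x l ih =>
    have hx : BetaEq (app (collect (l.length + 1) h) x)
        (collect l.length (lam (app (app (rename Nat.succ h) (var 0)) (rename Nat.succ x)))) := by
      refine (BetaEq.beta _ _).trans ?_
      rw [inst, subst_collect]
      simp only [subst, subst_rename, liftSubst, instSubst]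
      rw [rename_eq_subst h]
      exact .refl _
    refine (hx.apps_left _).trans ((ih _).trans (BetaEq.apps_left ?_ l))
    refine (BetaEq.beta _ _).trans ?_
    change BetaEq (app (app (inst (rename Nat.succ h) z) z) (inst (rename Nat.succ x) z)) _
    rw [inst_rename_succ, inst_rename_succ]

/-! ### Simultaneous separation of normal terms -/

/-- The term that collects `M` arguments and passes them, together with its label `y`, to the next
argument. -/
def collector (M y : ℕ) : LambdaTerm := collect M (lam (app (var 0) (num y)))

theorem collector_closed (M y : ℕ) : (collector M y).Closed :=
  closed_iff_below.2 (collect_below ⟨Nat.one_pos, (num_closed y).below 1⟩)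

theorem betaEq_collector (y : ℕ) (l : List LambdaTerm) (z : LambdaTerm) :
    BetaEq (apps (collector l.length y) (l ++ [z])) (apps (app z (num y)) l) := by
  refine (betaEq_collect _ z l).trans (BetaEq.apps_left ((BetaEq.beta _ _).trans ?_) l)
  simp only [inst, subst, (num_closed y).subst_eq]
  exact .refl _

/-- The substitution that replaces the variables of a context of length `V` with collectors. -/
def collectorSubst (M V : ℕ) : ℕ → LambdaTerm := fun i => collector M (V - 1 - i)

/-- The label `V - 1 - i` counts variables from the outermost one, so it does not change when the
context grows. -/
theorem scons_collectorSubst (M V : ℕ) :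
    scons (collector M V) (collectorSubst M V) = collectorSubst M (V + 1) := by
  funext i
  cases i with
  | zero => rfl
  | succ i =>
    simp only [scons, collectorSubst]
    congr 1
    omega

/-- The body of a term, after an η-expansion if it is not an abstraction. -/
def body : LambdaTerm → LambdaTerm
  | lam u => u
  | var i => app (var (i + 1)) (var 0)
  | app u v => app (rename Nat.succ (app u v)) (var 0)

theorem body_eq {t : LambdaTerm} (ht : ¬ t.IsLam) :
    body t = app (rename Nat.succ t) (var 0) := by
  cases t with
  | lam u => exact absurd ⟨u, rfl⟩ ht
  | _ => rfl

theorem etaEq_lam_body (t : LambdaTerm) : EtaEq (lam (body t)) t := by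
  by_cases ht : t.IsLam
  · obtain ⟨u, rfl⟩ := ht
    exact .refl _
  · rw [body_eq ht]
    exact .rel _ _ (.eta t)

/-- Applying to the next collector strips one abstraction, real or created by η-expansion, so terms
with different numbers of abstractions are treated uniformly. -/
theorem betaEq_app_collector (M V : ℕ) (t : LambdaTerm) :
    BetaEq (app (subst (collectorSubst M V) t) (collector M V))
      (subst (collectorSubst M (V + 1)) (body t)) := by
  rw [← scons_collectorSubst]
  by_cases ht : t.IsLam
  · obtain ⟨u, rfl⟩ := ht
    refine (BetaEq.beta _ _).trans ?_
    rw [inst_subst_liftSubst]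
    exact .refl _
  · rw [body_eq ht, subst, subst_rename]
    exact .refl _

/-- The closed terms indexed by terms that respect η-equivalence. -/
abbrev EtaInvariant : Type :=
  {g : LambdaTerm → LambdaTerm // (∀ t, (g t).Closed) ∧ ∀ t s, EtaEq t s → g t = g s}

/-- The closed terms indexed by lists of terms that respect η-equivalence. -/
abbrev ListEtaInvariant : Type :=
  {g : List LambdaTerm → LambdaTerm //
    (∀ l, (g l).Closed) ∧ ∀ l l', List.Forall₂ EtaEq l l' → g l = g l'}

/-- Every function that respects η-equivalence is definable on the terms of `S`, whose free
variables are replaced with collectors. -/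
def Separable (M V : ℕ) (S : Set LambdaTerm) : Prop :=
  ∀ g : EtaInvariant, ∃ E : LambdaTerm, E.Closed ∧
    ∀ t ∈ S, BetaEq (app E (subst (collectorSubst M V) t)) (g.1 t)

/-- The separator of the first term returns a separator for the remaining ones. -/
theorem Separable.list {M V : ℕ} {S : Set LambdaTerm} (h : Separable M V S) (m : ℕ)
    (g : ListEtaInvariant) : ∃ F : LambdaTerm, F.Closed ∧ ∀ l : List LambdaTerm, l.length = m →
      (∀ t ∈ l, t ∈ S) → BetaEq (apps F (l.map (subst (collectorSubst M V)))) (g.1 l) := by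
  induction m generalizing g with
  | zero =>
    refine ⟨g.1 [], g.2.1 [], fun l hl _ => ?_⟩
    rw [List.length_eq_zero_iff.1 hl]
    exact .refl _
  | succ m ih =>
    -- The choice is made once for each bundled function, so η-equivalent first terms, which give
    -- the same function of the tail, get the very same separator. This is why invariance is
    -- required as an equality.
    choose F hF hF' using ih
    have hrefl : ∀ l, List.Forall₂ EtaEq l l := fun l =>
      List.forall₂_same.2 fun _ _ => EqvGen.refl _
    let tail (t : LambdaTerm) : ListEtaInvariant :=
      ⟨fun l => g.1 (t :: l), fun l => g.2.1 _, fun l l' hl => g.2.2 _ _ (.cons (.refl _) hl)⟩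
    obtain ⟨E, hE, hE'⟩ := h ⟨fun t => F (tail t), fun t => hF _, fun t s hts => by
      have : tail t = tail s :=
        Subtype.ext (funext fun l => g.2.2 (t :: l) (s :: l) (.cons hts (hrefl l)))
      change F (tail t) = F (tail s)
      rw [this]⟩
    refine ⟨E, hE, fun l hl hS => ?_⟩
    cases l with
    | nil => cases hl
    | cons t l =>
      refine (BetaEq.apps_left (hE' t (hS t List.mem_cons_self)) _).trans ?_
      exact hF' (tail t) l (Nat.succ.inj hl) fun s hs => hS s (List.mem_cons_of_mem _ hs)

/-- The terms headed by a variable of a context of length `V`, with at most `M` arguments, which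
are in `S`. -/
def headVarSet (M V : ℕ) (S : Set LambdaTerm) : Set LambdaTerm :=
  {t | ∃ y l, y < V ∧ l.length ≤ M ∧ (∀ u ∈ l, u ∈ S) ∧ t = apps (var y) l}

/-- Böhm's argument for all terms at once. Feeding a list of handlers completes the unknown
arguments to exactly `M`; the collector then calls the next handler, whose position reveals the
number of arguments, and gives it the label of the head variable followed by the arguments. -/
theorem Separable.headVarSet {M V : ℕ} {S : Set LambdaTerm} (h : Separable M V S) :
    Separable M V (headVarSet M V S) := by
  intro g
  -- `konst M` swallows the `M` handlers still present once the arguments have been read: those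
  -- collected before the call and those after it.
  let G (y : ℕ) : ListEtaInvariant := ⟨fun l => konst M (g.1 (apps (var y) l)),
    fun l => konst_closed M (g.2.1 _),
    fun l l' hl => congrArg (konst M) (g.2.2 _ _ (EtaEq.apps (.refl _) hl))⟩
  choose F hF hF' using fun m y => h.list m (G y)
  choose e he he' using fun m => exists_betaEq_num (fun i => F m (V - 1 - i)) (fun i => hF _ _) V
  -- In decreasing order: with `m` own arguments, the collector absorbs `M - m` handlers, and the
  -- next one is `e m`.
  let es : List LambdaTerm := (List.range (M + 1)).map fun j => e (M - j)
  have hes : ∀ u ∈ es, u.Closed := by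
    intro u hu
    obtain ⟨j, -, rfl⟩ := List.mem_map.1 hu
    exact he _
  have hEs : ∀ x, BetaEq (app (lam (apps (var 0) es)) x) (apps x es) := fun x => by
    refine (BetaEq.beta _ _).trans ?_
    rw [inst, subst_apps, List.map_congr_left fun u hu => (hes u hu).subst_eq _, List.map_id']
    exact .refl _
  have hclosed : (lam (apps (var 0) es)).Closed := by
    rw [closed_iff_below]
    exact Below.apps (n := 1) Nat.one_pos fun u hu => (hes u hu).below 1
  refine ⟨_, hclosed, ?_⟩
  rintro _ ⟨y, l, hy, hl, hS, rfl⟩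
  refine (hEs _).trans ?_
  rw [subst_apps]
  set l' := l.map (subst (collectorSubst M V)) with hl'
  have hlen : l'.length = l.length := List.length_map _
  have hget : M - l.length < es.length := by simp [es]
  have hsplit : es = es.take (M - l.length) ++ [e l.length] ++ es.drop (M - l.length + 1) := by
    conv_lhs => rw [← List.take_append_drop (M - l.length) es, List.drop_eq_getElem_cons hget]
    have : es[M - l.length] = e l.length := by
      simp only [es, List.getElem_map, List.getElem_range]
      congr 1
      omega
    rw [this, List.append_assoc]
    rfl
  set es₁ := es.take (M - l.length) with hes₁
  set es₂ := es.drop (M - l.length + 1) with hes₂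
  have hlen₁ : (l' ++ es₁).length = M := by
    simp [hlen, hes₁, es]
    omega
  have hlen₂ : (es₁ ++ es₂).length = M := by
    simp [hes₁, hes₂, es]
    omega
  have hcat : ∀ x, apps (apps x l') (es₁ ++ [e l.length] ++ es₂) =
      apps (apps x (l' ++ es₁ ++ [e l.length])) es₂ := fun x => by simp [apps_append]
  rw [hsplit, hcat]
  have h₁ := betaEq_collector (V - 1 - y) (l' ++ es₁) (e l.length)
  rw [hlen₁] at h₁
  refine (h₁.apps_left es₂).trans ?_
  rw [← apps_append, List.append_assoc, apps_append]
  have h₂ := he' l.length (V - 1 - y) (by omega)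
  rw [show V - 1 - (V - 1 - y) = y by omega] at h₂
  refine (((h₂.apps_left l').trans (hF' l.length y l rfl hS)).apps_left _).trans ?_
  have h₃ := betaEq_konst (g.1 (apps (var y) l)) (es₁ ++ es₂)
  rw [hlen₂] at h₃
  exact h₃

theorem Separable.body {M V : ℕ} {S S' : Set LambdaTerm} (h : Separable M (V + 1) S')
    (hS : ∀ t ∈ S, body t ∈ S') : Separable M V S := by
  intro g
  obtain ⟨E, hE, hE'⟩ := h ⟨fun t => g.1 (lam t), fun t => g.2.1 _, fun t s hts =>
    g.2.2 _ _ hts.lam⟩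
  refine ⟨lam (app E (app (var 0) (collector M V))), ?_, fun t ht => ?_⟩
  · rw [closed_iff_below]
    exact ⟨hE.below 1, Nat.one_pos, (collector_closed M V).below 1⟩
  · refine (BetaEq.beta _ _).trans ?_
    simp only [inst, subst, hE.subst_eq, (collector_closed M V).subst_eq, instSubst]
    refine ((BetaEq.refl E).app (betaEq_app_collector M V t)).trans ((hE' _ (hS t ht)).trans ?_)
    change BetaEq (g.1 (lam (LambdaTerm.body t))) (g.1 t)
    rw [g.2.2 _ _ (etaEq_lam_body t)]

theorem Separable.iterate_body {M V k : ℕ} {S S' : Set LambdaTerm}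
    (h : Separable M (V + k) S') (hS : ∀ t ∈ S, LambdaTerm.body^[k] t ∈ S') :
    Separable M V S := by
  induction k generalizing V S with
  | zero =>
    intro g
    obtain ⟨E, hE, hE'⟩ := h g
    exact ⟨E, hE, fun t ht => hE' t (hS t ht)⟩
  | succ k ih =>
    refine Separable.body (S' := {t | LambdaTerm.body^[k] t ∈ S'})
      (ih (by rwa [Nat.add_right_comm]) fun t ht => ht) fun t ht => ?_
    have := hS t ht
    rwa [Function.iterate_succ_apply] at this

/-- The normal terms of size at most `d` in a context of length `V`. -/
def smallNormal (d V : ℕ) : Set LambdaTerm := {t | t.Normal ∧ t.size ≤ d ∧ Below V t}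

theorem size_rename (ρ : ℕ → ℕ) (t : LambdaTerm) : (rename ρ t).size = t.size := by
  induction t generalizing ρ with
  | var i => rfl
  | app u v ihu ihv => simp only [rename, size, ihu, ihv]
  | lam u ih => simp only [rename, size, ih]

theorem BetaStep.of_rename {ρ : ℕ → ℕ} {u w : LambdaTerm}
    (h : BetaStep (LambdaTerm.rename ρ u) w) : ∃ u', BetaStep u u' := by
  induction u generalizing ρ w with
  | var i => cases h
  | lam u ih =>
    cases h with
    | lam h =>
      obtain ⟨u', hu⟩ := ih h
      exact ⟨_, .lam hu⟩
  | app u v ihu ihv =>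
    rw [LambdaTerm.rename] at h
    generalize hx : LambdaTerm.rename ρ u = x at h
    cases h with
    | beta a _ =>
      cases u with
      | lam b => exact ⟨_, .beta b v⟩
      | _ => cases hx
    | appL _ h =>
      obtain ⟨u', hu⟩ := ihu (hx ▸ h)
      exact ⟨_, .appL v hu⟩
    | appR _ h =>
      obtain ⟨v', hv⟩ := ihv h
      exact ⟨_, .appR u hv⟩

theorem rename_succ_mem_smallNormal {d V : ℕ} {t : LambdaTerm} (h : t ∈ smallNormal d V) :
    rename Nat.succ t ∈ smallNormal d (V + 1) := by
  refine ⟨fun w hw => ?_, by rw [size_rename]; exact h.2.1,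
    h.2.2.rename fun i hi => Nat.succ_lt_succ hi⟩
  obtain ⟨u', hu⟩ := hw.of_rename
  exact h.1 _ hu

theorem body_mem_headVarSet {M d V : ℕ} (hd : 0 < d) {t : LambdaTerm}
    (h : t ∈ headVarSet M V (smallNormal d V)) :
    LambdaTerm.body t ∈ headVarSet (M + 1) (V + 1) (smallNormal d (V + 1)) := by
  obtain ⟨y, l, hy, hl, hS, rfl⟩ := h
  refine ⟨y + 1, l.map (rename Nat.succ) ++ [var 0], by omega, by simpa using hl, ?_, ?_⟩
  · intro u hu
    rcases List.mem_append.1 hu with hu | hu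
    · obtain ⟨v, hv, rfl⟩ := List.mem_map.1 hu
      exact rename_succ_mem_smallNormal (hS v hv)
    · rw [List.mem_singleton.1 hu]
      exact ⟨fun w hw => (by cases hw), hd, Nat.succ_pos V⟩
  · rw [body_eq (apps_var_ne_lam y l), rename_apps, apps_concat]
    rfl

theorem iterate_body_mem_headVarSet_of_mem {M d V k : ℕ} (hd : k ≤ d) {t : LambdaTerm}
    (h : t ∈ headVarSet M V (smallNormal d V)) :
    LambdaTerm.body^[k] t ∈ headVarSet (M + k) (V + k) (smallNormal d (V + k)) := by
  induction k with
  | zero => exact h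
  | succ k ih =>
    rw [Function.iterate_succ_apply']
    exact body_mem_headVarSet (by omega) (ih (by omega))

theorem apps_var_mem_headVarSet {y d V : ℕ} {l : List LambdaTerm}
    (h : apps (var y) l ∈ smallNormal (d + 1) V) :
    apps (var y) l ∈ headVarSet d V (smallNormal d V) := by
  suffices y < V ∧ l.length + 1 ≤ size (apps (var y) l) ∧ ∀ u ∈ l, u ∈ smallNormal d V from
    ⟨y, l, this.1, by have := h.2.1; omega, this.2.2, rfl⟩
  induction l using List.reverseRecOn generalizing d with
  | nil => exact ⟨h.2.2, le_rfl, by simp⟩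
  | append_singleton l v ih =>
    rw [apps_concat] at h ⊢
    obtain ⟨hn, hs, hb⟩ := h
    rw [size] at hs ⊢
    have hv := size_pos v
    cases d with
    | zero => omega
    | succ d =>
      obtain ⟨hy, hl, hS⟩ := ih (d := d) ⟨hn.of_app_left, by omega, hb.1⟩
      refine ⟨hy, by simp; omega, fun u hu => ?_⟩
      rcases List.mem_append.1 hu with hu | hu
      · obtain ⟨h₁, h₂, h₃⟩ := hS u hu
        exact ⟨h₁, by omega, h₃⟩
      · rw [List.mem_singleton.1 hu]
        exact ⟨hn.of_app_right, by omega, hb.2⟩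

theorem headVarSet_mono {M M' V : ℕ} (h : M ≤ M') (S : Set LambdaTerm) :
    headVarSet M V S ⊆ headVarSet M' V S :=
  fun _ ⟨y, l, hy, hl, h'⟩ => ⟨y, l, hy, hl.trans h, h'⟩

/-- A term of size at most `k + 1` has at most `k` leading abstractions. Once the head variable is
exposed, each further passage to the body adds one variable as an argument, hence the bound `d + k`.
-/
theorem iterate_body_mem_headVarSet {d V k : ℕ} (hk : k ≤ d) {t : LambdaTerm}
    (h : t ∈ smallNormal (d + 1) V) (ht : t.size ≤ k + 1) :
    LambdaTerm.body^[k] t ∈ headVarSet (d + k) (V + k) (smallNormal d (V + k)) := by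
  rcases whStep_or_isLam_or_apps t with ⟨v, hv⟩ | ⟨u, rfl⟩ | ⟨y, l, rfl⟩
  · exact absurd hv.betaStep (h.1 v)
  · cases k with
    | zero =>
      have := size_pos u
      simp only [size] at ht
      omega
    | succ k =>
      rw [Function.iterate_succ_apply]
      simp only [size] at ht
      have hs := h.2.1
      simp only [size] at hs
      have := iterate_body_mem_headVarSet (k := k) (by omega)
        (show u ∈ smallNormal (d + 1) (V + 1) from ⟨h.1.of_lam, by omega, h.2.2⟩) (by omega)
      rw [Nat.add_right_comm] at this
      exact headVarSet_mono (by omega) _ this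
  · exact iterate_body_mem_headVarSet_of_mem hk (apps_var_mem_headVarSet h)
termination_by k

/-- Induction on the size bound: after `d` bodies every term of size at most `d + 1` is headed by a
variable, with arguments of size at most `d`. Half of `M` accounts for the original arguments, half
for those added by η-expansion. -/
theorem separable_smallNormal {M d : ℕ} (hd : 2 * d ≤ M) (V : ℕ) :
    Separable M V (smallNormal d V) := by
  induction d generalizing V with
  | zero =>
    intro g
    refine ⟨g.1 (var 0), g.2.1 _, fun t ht => absurd ht.2.1 ?_⟩
    have := size_pos t
    omega
  | succ d ih =>
    refine Separable.iterate_body (k := d) (ih (by omega) (V + d)).headVarSet fun t ht => ?_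
    exact headVarSet_mono (by omega) _ (iterate_body_mem_headVarSet le_rfl ht ht.2.1)

/-- Finitely many closed normal terms that are pairwise not η-equivalent can be separated. -/
theorem exists_separator (l : List LambdaTerm) (hl : ∀ t ∈ l, t.Closed ∧ t.Normal)
    (hη : ∀ i j (hi : i < l.length) (hj : j < l.length), EtaEq l[i] l[j] → i = j) :
    ∃ E : LambdaTerm, E.Closed ∧ ∀ i (hi : i < l.length),
      BetaEq (app E l[i]) (proj l.length i) := by
  let d := (l.map size).sum
  let P (t : LambdaTerm) : Set ℕ := {i | ∃ hi : i < l.length, EtaEq t l[i]}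
  obtain ⟨E, hE, hE'⟩ := separable_smallNormal (d := d) le_rfl 0
    -- The index of the η-class of `t` in the list; a term outside all these classes gets the
    -- default `sInf ∅ = 0`, which is harmless.
    ⟨fun t => proj l.length (sInf (P t)), fun t => proj_closed _ _, fun t s hts => by
      have : P t = P s := Set.ext fun i =>
        ⟨fun ⟨hi, h⟩ => ⟨hi, .trans _ _ _ (.symm _ _ hts) h⟩,
          fun ⟨hi, h⟩ => ⟨hi, .trans _ _ _ hts h⟩⟩
      change proj _ (sInf (P t)) = proj _ (sInf (P s))
      rw [this]⟩
  refine ⟨E, hE, fun i hi => ?_⟩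
  have hmem := List.getElem_mem hi
  have h := hE' l[i] ⟨(hl _ hmem).2, List.single_le_sum (by simp) _ (List.mem_map_of_mem hmem),
    (hl _ hmem).1.below 0⟩
  have hP : P l[i] = {i} := Set.ext fun j => by
    refine ⟨fun ⟨hj, h⟩ => (hη i j hi hj h).symm, ?_⟩
    rintro rfl
    exact ⟨hi, .refl _⟩
  rw [(hl _ hmem).1.subst_eq] at h
  simpa [hP] using h

theorem exists_isStorageOperator {D : Set LambdaTerm} (hD : ∀ t ∈ D, t.Closed ∧ t.Normal)
    (hfin : D.Finite) (hη : ∀ t ∈ D, ∀ s ∈ D, EtaEq t s → t = s) :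
    ∃ T, IsStorageOperator D T := by
  obtain ⟨l, hnd, hl⟩ : ∃ l : List LambdaTerm, l.Nodup ∧ ∀ t, t ∈ l ↔ t ∈ D :=
    ⟨hfin.toFinset.toList, Finset.nodup_toList _, by simp⟩
  have hlD : ∀ t ∈ l, t.Closed ∧ t.Normal := fun t ht => hD t ((hl t).1 ht)
  obtain ⟨E, hE, hE'⟩ := exists_separator l hlD fun i j hi hj h => by
    have := hη _ ((hl _).1 (List.getElem_mem hi)) _ ((hl _).1 (List.getElem_mem hj)) h
    exact (List.Nodup.getElem_inj_iff hnd).1 this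
  -- `T` selects the stored value `(f)tᵢ` among finitely many prepared ones, so `τ = t` and the
  -- substitution is trivial.
  let T := lam (lam (apps (app E (var 1)) (l.map fun t => app (var 0) t)))
  have hT : T.Closed := by
    rw [closed_iff_below]
    refine Below.apps (n := 2) ⟨hE.below 2, Nat.one_lt_two⟩ fun u hu => ?_
    obtain ⟨t, ht, rfl⟩ := List.mem_map.1 hu
    exact ⟨Nat.two_pos, (hlD t ht).1.below 2⟩
  refine ⟨T, hT, fun t ht => ⟨hT, t, .refl t, fun θ hθ f _ => ⟨var, ?_⟩⟩⟩
  obtain ⟨i, hi, rfl⟩ := List.getElem_of_mem ((hl t).2 ht)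
  have hstart : WhTrans (app (app T θ) (var f))
      (apps (app E θ) (l.map fun t => app (var f) t)) := by
    refine whTrans_beta₂ ?_
    rw [subst_apps, inst, subst_apps, List.map_map, List.map_map]
    congr 1
    · simp only [subst, hE.subst_eq, liftSubst, instSubst]
      exact congrArg _ (inst_rename_succ θ _)
    · refine List.map_congr_left fun u hu => ?_
      simp [subst, (hlD u hu).1.subst_eq, liftSubst, instSubst]
  let n := l.length
  let xs := (List.range n).map var
  have hxs : xs.length = n := by simp [xs]
  -- β-equivalence alone would not give a head reduction to `(f)tᵢ`. With fresh variables in place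
  -- of the `(f)tⱼ`, the result is a variable, which standardization reaches by weak head steps;
  -- these survive the substitution `ρ`. Shifting `θ` by `n` keeps its free variables apart from the
  -- fresh ones.
  have hvar : BetaEq (apps (app E (rename (· + n) θ)) xs) (var i) := by
    have h₁ : BetaEq (app E (rename (· + n) θ)) (proj n i) := by
      have := hθ.rename (· + n)
      rw [(hlD _ (List.getElem_mem hi)).1.rename_eq] at this
      exact ((BetaEq.refl E).app this).trans (hE' i hi)
    refine (h₁.apps_left xs).trans ?_
    rw [← hxs]
    exact (betaEq_proj xs i (by rwa [hxs])).trans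
      (by simp only [xs, List.getElem_map, List.getElem_range]; exact .refl _)
  obtain ⟨k, hk⟩ := hvar.std (fun w hw => by cases hw)
  cases hk with
  | var hk =>
    let ρ : ℕ → LambdaTerm := fun j => if hj : j < n then app (var f) l[j] else var (j - n)
    have hρ := hk.subst ρ
    have h₁ : subst ρ (rename (· + n) θ) = θ := by
      rw [subst_rename]
      conv_rhs => rw [← subst_var θ]
      congr 1
      funext j
      simp [ρ]
    have h₂ : xs.map (subst ρ) = l.map fun t => app (var f) t := by
      refine List.ext_getElem (by simp [hxs, n]) fun j h h' => ?_
      have hj : j < n := by simpa [xs] using h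
      simp [xs, subst, ρ, hj]
    rw [subst_apps, h₂] at hρ
    change Steps WhStep k (apps (app (subst ρ E) (subst ρ (rename (· + n) θ))) _) _ at hρ
    rw [hE.subst_eq, h₁] at hρ
    have hρi : subst ρ (var i) = app (var f) l[i] := by
      have : i < n := hi
      simp [subst, ρ, this]
    rw [hρi] at hρ
    rw [subst_var]
    obtain ⟨j, hj⟩ := hstart.steps
    exact (hj.trans hρ).headRed

end LambdaTerm

theorem theorem4p2 :
    -- (1)
    (∀ D : Set LambdaTerm, (∀ t ∈ D, t.Closed ∧ t.Normal) →
      ∀ T T' : LambdaTerm, T.Closed → T'.Closed →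
        LambdaTerm.IsStorageOperator D T → LambdaTerm.BetaEq T' T → LambdaTerm.IsStorageOperator D T') ∧
    -- (2), first half
    (∀ D : Set LambdaTerm, (∀ t ∈ D, t.Closed ∧ t.Normal) →
      D.Nonempty → (∃ T, LambdaTerm.IsStorageOperator D T) →
        ¬ ComputablePred (fun T : LambdaTerm => LambdaTerm.IsStorageOperator D T)) ∧
    -- (2), second half
    (∀ D : Set LambdaTerm, (∀ t ∈ D, t.Closed ∧ t.Normal) → D.Finite →
      REPred (fun T : LambdaTerm => LambdaTerm.IsStorageOperator D T)) ∧
    -- (3)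
    (∀ D : Set LambdaTerm, (∀ t ∈ D, t.Closed ∧ t.Normal) → D.Finite →
      (∃ nf : LambdaTerm → LambdaTerm,
        (∀ t ∈ D, LambdaTerm.IsBetaEtaNormalForm t (nf t)) ∧ Set.InjOn nf D) →
        ∃ T, LambdaTerm.IsStorageOperator D T) ∧
    -- (4)
    (∀ t T : LambdaTerm, t.Closed → t.Normal → T.Closed → T.IsStorageOperatorFor t →
      ∃ A B : ℕ, ∀ θ : LambdaTerm, LambdaTerm.BetaEq θ t → ∀ f : ℕ, f ∉ θ.Fv →
        ∃ n N : ℕ, ((T.app θ).app (.var f)).HeadLength n ∧ θ.NormLength N ∧ n ≤ A * N + B) := by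
  refine ⟨fun D hD T T' _ hT' h hTT' => h.of_betaEq hD hT' hTT',
    fun D hD hne hT => LambdaTerm.not_computablePred_isStorageOperator hD hne hT,
    fun D hD hfin => LambdaTerm.rePred_isStorageOperator hD hfin,
    fun D hD hfin ⟨nf, hnf, hinj⟩ => ?_, fun t T ht htn _ h => ?_⟩
  · refine LambdaTerm.exists_isStorageOperator hD hfin fun t ht s hs hts => hinj ht hs ?_
    exact hts.eq_of_isBetaEtaNormalForm (hD t ht).2 (hD s hs).2 (hnf t ht) (hnf s hs)
  · obtain ⟨A, B, h⟩ := h.headLength_le ht htn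
    exact ⟨A, B, fun θ hθ f _ => h θ hθ f⟩
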